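/- Let $f:\mathbb R^n\to\mathbb R^n$ be locally Lipschitz, $h:\mathbb R^n\to\mathbb R$ continuous and $\mathcal X_0\subset\mathbb R^n$ open. Suppose that for every $x\in\mathcal X_0$ the solution $t\mapsto X(t;x)$ of $\dot X=f(X)$, $X(0;x)=x$, is defined for all $t\in\mathbb R$, and that there is $\gamma_0>0$ such that for every $x\in\mathcal X_0$ there is $C>0$ with $e^{\gamma_0 t}|h(X(t;x))|\le C$ for all $t\le 0$. Put $\mathcal X=\{X(t;x):x\in\mathcal X_0,\ t\ge 0\}$ and fix $\gamma>\gamma_0$. For an interval $J\subset\mathbb R$, a set $S\in\{[0,1),[0,1]\}$ and $u:J\to\mathbb R$, call $w:J\times[0,1]\to\mathbb R$ a classical solution on $J\times S$ with datum $u$ if $w$ is continuous on $J\times[0,1]$, the derivatives $\partial_tw,\partial_\lambda w,\partial_\lambda^2w$ exist (one-sided at end points) and are continuous on $J\times S$, and $$\partial_t w=\partial_\lambda^2w-\gamma w\ \text{ on } J\times S,\qquad \partial_\lambda w(t,0)=0,\qquad w(t,1)=u(t)\qquad (t\in J).$$ Then the following hold. 1. For every $x\in\mathcal X$, with $u_x(t):=-h(X(t;x))$,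 there is exactly one classical solution $w_{u_x}$ on $(-\infty,0]\times[0,1)$ with datum $u_x$ such that, for some $C>0$, $\|w_{u_x}(t,\cdot)\|_{L^2(0,1)}<Ce^{-\gamma t}$ for all $t\le 0$. Hence $T_0(x,\lambda):=w_{u_x}(0,\lambda)$ is well defined for $x\in\mathcal X$, $\lambda\in[0,1]$. 2. For every $x\in\mathcal X_0$, the function $(t,\lambda)\mapsto T_0(X(t;x),\lambda)$ is a classical solution on $[0,\infty)\times[0,1)$ with datum $t\mapsto -h(X(t;x))$, that is, for $t\ge 0$, $$\partial_tT_0(X(t;x),\lambda)=\partial_\lambda^2T_0(X(t;x),\lambda)-\gamma T_0(X(t;x),\lambda)\ (0\le\lambda<1),\quad \partial_\lambda T_0(X(t;x),0)=0,\quad T_0(X(t;x),1)=-h(X(t;x)).$$ 3. If moreover $t\mapsto h(X(t;x))$ is continuously differentiable on $\mathbb R$ (for instance if $h$ is $C^1$), then it is a classical solution on $[0,\infty)\times[0,1]$; in particular the heat equation holds for all $\lambda\in[0,1]$. -/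

import Mathlib

open Set

/-- `c` is a trajectory of `ẋ = f(x)` defined for all times, with value `x` at time `0`. -/
def IsTrajectory {n : ℕ} (f : EuclideanSpace ℝ (Fin n) → EuclideanSpace ℝ (Fin n))
    (x : EuclideanSpace ℝ (Fin n)) (c : ℝ → EuclideanSpace ℝ (Fin n)) : Prop :=
  c 0 = x ∧ ∀ t : ℝ, HasDerivAt c (f (c t)) t

/-- The flow `X(t;x)` of `ẋ = f(x)`. It is meaningful at those `x` whose trajectory is defined for
all times (the trajectory is unique when `f` is locally Lipschitz); elsewhere it is the junk value
`x`. -/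
noncomputable def flow {n : ℕ} (f : EuclideanSpace ℝ (Fin n) → EuclideanSpace ℝ (Fin n))
    (t : ℝ) (x : EuclideanSpace ℝ (Fin n)) : EuclideanSpace ℝ (Fin n) :=
  open Classical in
  if hx : ∃ c : ℝ → EuclideanSpace ℝ (Fin n), IsTrajectory f x c then hx.choose t else x

/-- The set `𝒳 = {X(t;x) : x ∈ 𝒳₀, t ≥ 0}` of trajectories of interest. -/
def trajectorySet {n : ℕ} (f : EuclideanSpace ℝ (Fin n) → EuclideanSpace ℝ (Fin n))
    (X₀ : Set (EuclideanSpace ℝ (Fin n))) : Set (EuclideanSpace ℝ (Fin n)) :=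
  {y | ∃ x ∈ X₀, ∃ t : ℝ, 0 ≤ t ∧ y = flow f t x}

/-- `w` is a classical solution, for times in `J`, of
`∂ₜw = ∂²w/∂l² - γ w`, `∂w/∂l (t,0) = 0`, `w(t,1) = u(t)`.
The function `w` is continuous on `J × [0,1]`; on `J × S` the derivatives `∂ₜw`, `∂w/∂l`,
`∂²w/∂l²` exist (one-sided at the end points), are continuous, and satisfy the equation.
This is used with `S = [0,1)` and with `S = [0,1]`. -/
structure IsHeatSolution (γ : ℝ) (J S : Set ℝ) (u : ℝ → ℝ) (w : ℝ → ℝ → ℝ) : Prop where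
  continuousOn : ContinuousOn (fun p : ℝ × ℝ => w p.1 p.2) (J ×ˢ Icc (0 : ℝ) 1)
  heat_neumann : ∃ wt wl wll : ℝ → ℝ → ℝ,
    ContinuousOn (fun p : ℝ × ℝ => wt p.1 p.2) (J ×ˢ S) ∧
    ContinuousOn (fun p : ℝ × ℝ => wl p.1 p.2) (J ×ˢ S) ∧
    ContinuousOn (fun p : ℝ × ℝ => wll p.1 p.2) (J ×ˢ S) ∧
    (∀ t ∈ J, ∀ l ∈ S,
      HasDerivWithinAt (fun s => w s l) (wt t l) J t ∧
      HasDerivWithinAt (fun r => w t r) (wl t l) S l ∧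
      HasDerivWithinAt (fun r => wl t r) (wll t l) S l ∧
      wt t l = wll t l - γ * w t l) ∧
    (∀ t ∈ J, wl t 0 = 0)
  dirichlet : ∀ t ∈ J, w t 1 = u t

/-- `w` is a solution on `(-∞,0]`, without initial condition, of the heat equation with boundary
input `u` that satisfies `‖w(t,·)‖_{L²(0,1)} < C e^{-γ t}` for some constant `C`. -/
structure IsSteadySolution (γ : ℝ) (u : ℝ → ℝ) (w : ℝ → ℝ → ℝ) : Prop where
  isHeatSolution : IsHeatSolution γ (Iic 0) (Ico 0 1) u w
  growth : ∃ C : ℝ, 0 < C ∧ ∀ t : ℝ, t ≤ 0 →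
    Real.sqrt (∫ l in (0 : ℝ)..1, (w t l) ^ 2) < C * Real.exp (-γ * t)

/-- The solution `w_u` on `(-∞,0]` of the heat equation without initial condition
(the junk value `0` when there is none). -/
noncomputable def steadySolution (γ : ℝ) (u : ℝ → ℝ) : ℝ → ℝ → ℝ :=
  open Classical in
  if hu : ∃ w : ℝ → ℝ → ℝ, IsSteadySolution γ u w then hu.choose else fun _ _ => 0

/-- The boundary input `u_x(t) = -h(X(t;x))`. -/
noncomputable def boundaryInput {n : ℕ}
    (f : EuclideanSpace ℝ (Fin n) → EuclideanSpace ℝ (Fin n))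
    (h : EuclideanSpace ℝ (Fin n) → ℝ) (x : EuclideanSpace ℝ (Fin n)) : ℝ → ℝ :=
  fun t => -h (flow f t x)

/-- The KKL mapping `T₀(x,l) = w_{u_x}(0,l)`. -/
noncomputable def kklMap {n : ℕ} (γ : ℝ)
    (f : EuclideanSpace ℝ (Fin n) → EuclideanSpace ℝ (Fin n))
    (h : EuclideanSpace ℝ (Fin n) → ℝ) (x : EuclideanSpace ℝ (Fin n)) (l : ℝ) : ℝ :=
  steadySolution γ (boundaryInput f h x) 0 l

/-! Multiplying by `exp (γ t)` removes the term `-γ w`. The datum becomes `U = exp (γ t) u`, which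
decays at `-∞` with rate `δ = γ - γ₀ > 0`, and the growth condition becomes a uniform bound in
`L²(0,1)` for all `t ≤ 0`.

Existence, for all real times at once. Let `Gφ(t,y)` be the solution on the half line `y ≥ 0` with
boundary datum `φ`, given by the Poisson kernel. The function `Gφ(t,1-l) + Gφ(t,1+l)` is even in
`l`, so it satisfies the Neumann condition at `l = 0`, and its value at `l = 1` is `φ + Gφ(·,2)`.
The operator `φ ↦ Gφ(·,2)` is a strict contraction for the weight `exp (δ t)`, so a Neumann series
solves `φ + Gφ(·,2) = U` (`exists_add_halfLineSolution_eq`). If `U` is `C¹`, so is `φ`, and then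
`Gφ` is regular up to `y = 0` (`continuousOn_halfLineDyy`), which gives regularity up to `l = 1`.

Uniqueness. The difference of two solutions has zero datum and is bounded in `L²` on `t ≤ 0`. Its
Fourier modes against `cos ((k + 1/2) π l)` satisfy `m' = -μ² m` and are bounded at `-∞`, hence
vanish (`integral_mul_cos_eq_zero`). These cosines are complete (`eq_zero_of_integral_mul_cos`).

Along the flow. Let `w` be the solution on all of `ℝ` with datum `-h(X(t;x))`. By the group property
of the flow, its translate by `a` is a steady solution for the point `X(a;x)`. Uniqueness gives
`T₀(X(a;x),·) = w(a,·)`, so `T₀` along the trajectory is `w` itself, and no gluing at `t = 0` is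
needed. -/

/-! ### Convolutions in time with exponentially decaying data. -/

section
open MeasureTheory Filter Topology

/-- `φ` is continuous and decays exponentially, with rate `δ`, at `-∞`. -/
structure HasExpDecay (δ : ℝ) (φ : ℝ → ℝ) : Prop where
  continuous : Continuous φ
  bound : ∀ T : ℝ, ∃ K : ℝ, ∀ t ≤ T, |φ t| ≤ K * Real.exp (δ * t)

/-- A kernel on the half line: continuous for positive times and positions, and bounded on
compact sets of positions, uniformly in time. -/
structure IsHalfLineKernel (k : ℝ → ℝ → ℝ) : Prop where
  continuousOn : ContinuousOn (fun p : ℝ × ℝ => k p.1 p.2) (Ioi 0 ×ˢ Ioi 0)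
  bounded : ∀ a b : ℝ, 0 < a → ∃ M : ℝ, ∀ τ > 0, ∀ y ∈ Icc a b, |k τ y| ≤ M

/-- The convolution in time of the kernel `k` with `φ`. -/
noncomputable def kernelIntegral (k : ℝ → ℝ → ℝ) (φ : ℝ → ℝ) (t y : ℝ) : ℝ :=
  ∫ τ in Ioi (0 : ℝ), k τ y * φ (t - τ)

variable {δ : ℝ} {φ : ℝ → ℝ} {k k' : ℝ → ℝ → ℝ}

theorem HasExpDecay.exists_bound (hδ : 0 < δ) (hφ : HasExpDecay δ φ) (T : ℝ) :
    ∃ K : ℝ, 0 ≤ K ∧ ∀ t ≤ T, ∀ τ ≥ 0, |φ (t - τ)| ≤ K * Real.exp (-δ * τ) := by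
  obtain ⟨K, hK⟩ := hφ.bound T
  have hK0 : 0 ≤ K := by
    have := (abs_nonneg _).trans (hK T le_rfl)
    exact nonneg_of_mul_nonneg_left this (Real.exp_pos _)
  refine ⟨K * Real.exp (δ * T), by positivity, fun t ht τ hτ => (hK _ (by linarith)).trans ?_⟩
  rw [mul_assoc, ← Real.exp_add]
  gcongr
  nlinarith

theorem integrableOn_exp_neg_mul (hδ : 0 < δ) (K : ℝ) :
    IntegrableOn (fun τ : ℝ => K * Real.exp (-δ * τ)) (Ioi 0) :=
  (exp_neg_integrableOn_Ioi 0 hδ).const_mul K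

theorem IsHalfLineKernel.aestronglyMeasurable (hk : IsHalfLineKernel k) (hφ : Continuous φ)
    {y : ℝ} (hy : 0 < y) (t : ℝ) :
    AEStronglyMeasurable (fun τ => k τ y * φ (t - τ)) (volume.restrict (Ioi 0)) := by
  refine ContinuousOn.aestronglyMeasurable ?_ measurableSet_Ioi
  refine ContinuousOn.mul ?_ (by fun_prop)
  exact hk.continuousOn.comp (f := fun τ : ℝ => (τ, y)) (by fun_prop) fun τ hτ => ⟨hτ, hy⟩

/-- All integrability in `τ` comes from the decay of `φ` at `-∞`; the kernel only has to be bounded.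
The bound is uniform for `t ≤ T` and `y` in a compact set, as dominated convergence and
differentiation under the integral require. -/
theorem IsHalfLineKernel.exists_dominated (hδ : 0 < δ) (hk : IsHalfLineKernel k)
    (hφ : HasExpDecay δ φ) (T : ℝ) {a : ℝ} (b : ℝ) (ha : 0 < a) :
    ∃ K : ℝ, ∀ t ≤ T, ∀ y ∈ Icc a b, ∀ τ > 0,
      |k τ y * φ (t - τ)| ≤ K * Real.exp (-δ * τ) := by
  obtain ⟨K, hK0, hK⟩ := hφ.exists_bound hδ T
  obtain ⟨M, hM⟩ := hk.bounded a b ha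
  refine ⟨M * K, fun t ht y hy τ hτ => ?_⟩
  rw [abs_mul, mul_assoc]
  have := hM τ hτ y hy
  exact mul_le_mul this (hK t ht τ hτ.le) (abs_nonneg _) ((abs_nonneg _).trans this)

theorem IsHalfLineKernel.integrableOn (hδ : 0 < δ) (hk : IsHalfLineKernel k)
    (hφ : HasExpDecay δ φ) (t : ℝ) {y : ℝ} (hy : 0 < y) :
    IntegrableOn (fun τ => k τ y * φ (t - τ)) (Ioi 0) := by
  obtain ⟨K, hK⟩ := hk.exists_dominated hδ hφ t y hy
  refine (integrableOn_exp_neg_mul hδ K).mono' (hk.aestronglyMeasurable hφ.continuous hy t) ?_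
  exact (ae_restrict_iff' measurableSet_Ioi).2 (ae_of_all _ fun τ hτ =>
    hK t le_rfl y ⟨le_rfl, le_rfl⟩ τ hτ)

theorem continuousOn_kernelIntegral (hδ : 0 < δ) (hk : IsHalfLineKernel k)
    (hφ : HasExpDecay δ φ) :
    ContinuousOn (fun p : ℝ × ℝ => kernelIntegral k φ p.1 p.2) (univ ×ˢ Ioi 0) := by
  rintro ⟨t₀, y₀⟩ ⟨-, hy₀ : 0 < y₀⟩
  obtain ⟨K, hK⟩ := hk.exists_dominated hδ hφ (t₀ + 1) (y₀ + 1) (half_pos hy₀)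
  have hnhds : ∀ᶠ p : ℝ × ℝ in 𝓝 (t₀, y₀), p.1 ≤ t₀ + 1 ∧ p.2 ∈ Icc (y₀ / 2) (y₀ + 1) := by
    refine ((continuous_fst.tendsto _).eventually (Iic_mem_nhds (by simp))).and
      ((continuous_snd.tendsto _).eventually (Icc_mem_nhds (by simpa using hy₀) (by simp)))
  refine ContinuousAt.continuousWithinAt ?_
  refine continuousAt_of_dominated (bound := fun τ => K * Real.exp (-δ * τ)) ?_ ?_
    (integrableOn_exp_neg_mul hδ K) ?_
  · filter_upwards [hnhds] with p hp
    exact hk.aestronglyMeasurable hφ.continuous ((half_pos hy₀).trans_le hp.2.1) p.1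
  · filter_upwards [hnhds] with p hp
    exact (ae_restrict_iff' measurableSet_Ioi).2 (ae_of_all _ fun τ hτ => hK _ hp.1 _ hp.2 τ hτ)
  · refine (ae_restrict_iff' measurableSet_Ioi).2 (ae_of_all _ fun τ (hτ : 0 < τ) => ?_)
    have h1 : ContinuousAt (fun p : ℝ × ℝ => k p.1 p.2) (τ, y₀) :=
      hk.continuousOn.continuousAt ((isOpen_Ioi.prod isOpen_Ioi).mem_nhds ⟨hτ, hy₀⟩)
    have h2 : ContinuousAt (fun p : ℝ × ℝ => k τ p.2) (t₀, y₀) :=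
      ContinuousAt.comp (f := fun p : ℝ × ℝ => (τ, p.2)) (x := (t₀, y₀)) h1 (by fun_prop)
    exact h2.mul (hφ.continuous.comp (by fun_prop)).continuousAt

theorem hasDerivAt_kernelIntegral_space (hδ : 0 < δ) (hk : IsHalfLineKernel k)
    (hk' : IsHalfLineKernel k') (hkk' : ∀ τ > 0, ∀ y > 0, HasDerivAt (k τ) (k' τ y) y)
    (hφ : HasExpDecay δ φ) (t : ℝ) {y : ℝ} (hy : 0 < y) :
    HasDerivAt (fun z => kernelIntegral k φ t z) (kernelIntegral k' φ t y) y := by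
  obtain ⟨K, hK⟩ := hk'.exists_dominated hδ hφ t (y + 1) (half_pos hy)
  have hs : Icc (y / 2) (y + 1) ∈ 𝓝 y := Icc_mem_nhds (by linarith) (by linarith)
  refine (hasDerivAt_integral_of_dominated_loc_of_deriv_le
    (F := fun z τ => k τ z * φ (t - τ)) (F' := fun z τ => k' τ z * φ (t - τ))
    (bound := fun τ => K * Real.exp (-δ * τ)) hs ?_ (hk.integrableOn hδ hφ t hy)
    (hk'.aestronglyMeasurable hφ.continuous hy t) ?_ (integrableOn_exp_neg_mul hδ K) ?_).2
  · filter_upwards [Ioi_mem_nhds hy] with z hz using hk.aestronglyMeasurable hφ.continuous hz t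
  · exact (ae_restrict_iff' measurableSet_Ioi).2 (ae_of_all _ fun τ hτ z hz =>
      hK _ le_rfl _ hz τ hτ)
  · exact (ae_restrict_iff' measurableSet_Ioi).2 (ae_of_all _ fun τ hτ z hz =>
      (hkk' τ hτ z ((half_pos hy).trans_le hz.1)).mul_const _)

/-- The time variable occurs only in the datum, so the derivative falls on `Φ` and the kernel is
left alone. -/
theorem hasDerivAt_kernelIntegral_time (hδ : 0 < δ) (hk : IsHalfLineKernel k) {Φ : ℝ → ℝ}
    (hΦ : HasExpDecay δ Φ) (hφ : HasExpDecay δ φ) (hΦφ : ∀ t, HasDerivAt Φ (φ t) t)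
    (t : ℝ) {y : ℝ} (hy : 0 < y) :
    HasDerivAt (fun s => kernelIntegral k Φ s y) (kernelIntegral k φ t y) t := by
  obtain ⟨K, hK⟩ := hk.exists_dominated hδ hφ (t + 1) y hy
  refine (hasDerivAt_integral_of_dominated_loc_of_deriv_le
    (F := fun s τ => k τ y * Φ (s - τ)) (F' := fun s τ => k τ y * φ (s - τ))
    (bound := fun τ => K * Real.exp (-δ * τ)) (Iic_mem_nhds (lt_add_one t)) ?_
    (hk.integrableOn hδ hΦ t hy) (hk.aestronglyMeasurable hφ.continuous hy t) ?_
    (integrableOn_exp_neg_mul hδ K) ?_).2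
  · exact Eventually.of_forall fun s => hk.aestronglyMeasurable hΦ.continuous hy s
  · exact (ae_restrict_iff' measurableSet_Ioi).2 (ae_of_all _ fun τ hτ s hs =>
      hK _ hs _ ⟨le_rfl, le_rfl⟩ τ hτ)
  · refine ae_of_all _ fun τ s _ => HasDerivAt.const_mul _ ?_
    exact (hΦφ (s - τ)).comp_sub_const s τ

/-- The primitive of `φ` that vanishes at `-∞`. -/
noncomputable def primitiveFromBot (φ : ℝ → ℝ) (t : ℝ) : ℝ := ∫ s in Iic t, φ s

theorem HasExpDecay.integrableOn_Iic (hδ : 0 < δ) (hφ : HasExpDecay δ φ) (t : ℝ) :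
    IntegrableOn φ (Iic t) := by
  obtain ⟨K, hK⟩ := hφ.bound t
  refine ((integrableOn_exp_mul_Iic hδ t).const_mul K).mono'
    hφ.continuous.aestronglyMeasurable ?_
  exact (ae_restrict_iff' measurableSet_Iic).2 (ae_of_all _ fun s hs => hK s hs)

theorem HasExpDecay.hasDerivAt_primitive (hδ : 0 < δ) (hφ : HasExpDecay δ φ) (t : ℝ) :
    HasDerivAt (primitiveFromBot φ) (φ t) t := by
  have h : primitiveFromBot φ = fun t => (∫ s in (0 : ℝ)..t, φ s) + ∫ s in Iic 0, φ s := by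
    ext t
    rw [← intervalIntegral.integral_Iic_sub_Iic (hφ.integrableOn_Iic hδ 0)
      (hφ.integrableOn_Iic hδ t), primitiveFromBot]
    ring
  rw [h]
  exact (hφ.continuous.integral_hasStrictDerivAt 0 t).hasDerivAt.add_const _

theorem HasExpDecay.primitive (hδ : 0 < δ) (hφ : HasExpDecay δ φ) :
    HasExpDecay δ (primitiveFromBot φ) := by
  refine ⟨continuous_iff_continuousAt.2 fun t =>
    (hφ.hasDerivAt_primitive hδ t).continuousAt, fun T => ?_⟩
  obtain ⟨K, hK⟩ := hφ.bound T
  refine ⟨K / δ, fun t ht => ?_⟩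
  calc |∫ s in Iic t, φ s| ≤ ∫ s in Iic t, K * Real.exp (δ * s) := by
        refine norm_integral_le_of_norm_le (f := φ) (μ := volume.restrict (Iic t))
          ((integrableOn_exp_mul_Iic hδ t).const_mul K) ?_
        exact (ae_restrict_iff' measurableSet_Iic).2 (ae_of_all _ fun s hs => hK s (le_trans hs ht))
    _ = K / δ * Real.exp (δ * t) := by
        rw [integral_const_mul, integral_exp_mul_Iic hδ]
        ring

end
-- The Poisson kernel of the half line and its derivatives.
section
open MeasureTheory Filter Topology

/-- The Gaussian factor of the heat kernels, with the factor `τ ^ (-3/2)`. -/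
noncomputable def gaussFactor (τ y : ℝ) : ℝ :=
  (2 * Real.sqrt Real.pi)⁻¹ * τ ^ (-(3 / 2) : ℝ) * Real.exp (-(y ^ 2 / (4 * τ)))

/-- The Poisson kernel of the heat equation on a half line. -/
noncomputable def boundaryKernel (τ y : ℝ) : ℝ := y * gaussFactor τ y

/-- The derivative in `y` of `boundaryKernel`. -/
noncomputable def boundaryKernelDy (τ y : ℝ) : ℝ := (1 - y ^ 2 / (2 * τ)) * gaussFactor τ y

/-- The second derivative in `y`, and the derivative in `τ`, of `boundaryKernel`. -/
noncomputable def boundaryKernelDyy (τ y : ℝ) : ℝ :=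
  (y ^ 3 / (4 * τ ^ 2) - 3 * y / (2 * τ)) * gaussFactor τ y

theorem gaussFactor_nonneg {τ : ℝ} (hτ : 0 < τ) (y : ℝ) : 0 ≤ gaussFactor τ y := by
  unfold gaussFactor
  positivity

theorem hasDerivAt_gaussFactor_space {τ : ℝ} (hτ : 0 < τ) (y : ℝ) :
    HasDerivAt (gaussFactor τ) (-(y / (2 * τ)) * gaussFactor τ y) y := by
  have h : HasDerivAt (fun y : ℝ => -(y ^ 2 / (4 * τ))) (-(y / (2 * τ))) y := by
    refine (((hasDerivAt_pow 2 y).div_const (4 * τ)).neg).congr_deriv ?_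
    field_simp
    norm_num
    ring
  refine (h.exp.const_mul ((2 * Real.sqrt Real.pi)⁻¹ * τ ^ (-(3 / 2) : ℝ))).congr_deriv ?_
  unfold gaussFactor
  ring

theorem hasDerivAt_gaussFactor_time {τ : ℝ} (hτ : 0 < τ) (y : ℝ) :
    HasDerivAt (fun τ => gaussFactor τ y)
      ((y ^ 2 / (4 * τ ^ 2) - 3 / (2 * τ)) * gaussFactor τ y) τ := by
  have h : HasDerivAt (fun τ : ℝ => -(y ^ 2 / (4 * τ))) (y ^ 2 / (4 * τ ^ 2)) τ := by
    have := ((((hasDerivAt_id τ).const_mul 4).fun_inv (by simpa using hτ.ne')).const_mul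
      (y ^ 2)).neg
    refine (this.congr_of_eventuallyEq (Eventually.of_forall fun s => ?_)).congr_deriv ?_
    · simp [div_eq_mul_inv]
    · simp only [id]
      field_simp
  have hp : HasDerivAt (fun τ : ℝ => τ ^ (-(3 / 2) : ℝ))
      (-(3 / (2 * τ)) * τ ^ (-(3 / 2) : ℝ)) τ := by
    refine (Real.hasDerivAt_rpow_const (p := -(3 / 2)) (Or.inl hτ.ne')).congr_deriv ?_
    rw [Real.rpow_sub_one hτ.ne']
    field_simp
  refine ((hp.const_mul (2 * Real.sqrt Real.pi)⁻¹).mul h.exp).congr_deriv ?_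
  unfold gaussFactor
  ring

theorem hasDerivAt_boundaryKernel_space {τ : ℝ} (hτ : 0 < τ) (y : ℝ) :
    HasDerivAt (boundaryKernel τ) (boundaryKernelDy τ y) y := by
  refine ((hasDerivAt_id y).mul (hasDerivAt_gaussFactor_space hτ y)).congr_deriv ?_
  simp only [boundaryKernelDy, id]
  field_simp
  ring

theorem hasDerivAt_boundaryKernelDy_space {τ : ℝ} (hτ : 0 < τ) (y : ℝ) :
    HasDerivAt (boundaryKernelDy τ) (boundaryKernelDyy τ y) y := by
  have h : HasDerivAt (fun y : ℝ => 1 - y ^ 2 / (2 * τ)) (-(y / τ)) y := by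
    refine (((hasDerivAt_pow 2 y).div_const (2 * τ)).const_sub 1).congr_deriv ?_
    field_simp
    norm_num
  refine (h.mul (hasDerivAt_gaussFactor_space hτ y)).congr_deriv ?_
  simp only [boundaryKernelDyy]
  field_simp
  ring

theorem hasDerivAt_boundaryKernel_time {τ : ℝ} (hτ : 0 < τ) (y : ℝ) :
    HasDerivAt (fun τ => boundaryKernel τ y) (boundaryKernelDyy τ y) τ := by
  refine ((hasDerivAt_gaussFactor_time hτ y).const_mul y).congr_deriv ?_
  simp only [boundaryKernelDyy]
  field_simp

theorem pow_mul_exp_neg_le {c z : ℝ} (hc : 0 < c) (hz : 0 ≤ z) (m : ℕ) :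
    z ^ m * Real.exp (-(c * z)) ≤ m.factorial / c ^ m := by
  have h := Real.pow_div_factorial_le_exp (c * z) (by positivity) m
  rw [div_le_iff₀ (by positivity)] at h
  rw [Real.exp_neg, ← div_eq_mul_inv, div_le_div_iff₀ (Real.exp_pos _) (by positivity)]
  calc z ^ m * c ^ m = (c * z) ^ m := by rw [mul_pow, mul_comm]
    _ ≤ _ := h
    _ = _ := mul_comm _ _

/-- Away from `y = 0` the factor `exp (-c/τ)`, with `c = a²/4`, beats every power of `1/τ`. This
single bound controls the kernel and its `y`-derivatives as `τ → 0`. -/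
theorem exists_gaussFactor_div_pow_le {a : ℝ} (ha : 0 < a) (j : ℕ) :
    ∃ M : ℝ, 0 ≤ M ∧ ∀ τ > 0, ∀ y ≥ a, gaussFactor τ y / τ ^ j ≤ M := by
  have hc : 0 < a ^ 2 / 4 := by positivity
  set c := a ^ 2 / 4 with hcdef
  refine ⟨(2 * Real.sqrt Real.pi)⁻¹ * (j.factorial / c ^ j + (j + 2).factorial / c ^ (j + 2)),
    by positivity, fun τ hτ y hy => ?_⟩
  have hz : 0 < τ⁻¹ := inv_pos.2 hτ
  -- Trades the fractional power for integer powers of `τ⁻¹`; the summand `1` covers large `τ`.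
  have h1 : τ ^ (-(3 / 2) : ℝ) ≤ 1 + τ⁻¹ ^ 2 := by
    rw [Real.rpow_neg hτ.le, ← Real.inv_rpow hτ.le]
    rcases le_total τ⁻¹ 1 with h | h
    · have := Real.rpow_le_one hz.le h (by norm_num : (0 : ℝ) ≤ 3 / 2)
      nlinarith [sq_nonneg τ⁻¹]
    · have := Real.rpow_le_rpow_of_exponent_le h (by norm_num : (3 / 2 : ℝ) ≤ 2)
      rw [Real.rpow_two] at this
      linarith
  have h2 : Real.exp (-(y ^ 2 / (4 * τ))) ≤ Real.exp (-(c * τ⁻¹)) := by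
    apply Real.exp_le_exp.2
    rw [hcdef, neg_le_neg_iff, ← div_eq_mul_inv, div_div]
    gcongr
  calc gaussFactor τ y / τ ^ j
      = (2 * Real.sqrt Real.pi)⁻¹ *
          ((τ⁻¹ ^ j * τ ^ (-(3 / 2) : ℝ)) * Real.exp (-(y ^ 2 / (4 * τ)))) := by
        unfold gaussFactor
        rw [inv_pow]
        ring
    _ ≤ (2 * Real.sqrt Real.pi)⁻¹ *
          ((τ⁻¹ ^ j * (1 + τ⁻¹ ^ 2)) * Real.exp (-(c * τ⁻¹))) := by gcongr
    _ = (2 * Real.sqrt Real.pi)⁻¹ * (τ⁻¹ ^ j * Real.exp (-(c * τ⁻¹)) +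
          τ⁻¹ ^ (j + 2) * Real.exp (-(c * τ⁻¹))) := by ring
    _ ≤ _ := by
        gcongr
        · exact pow_mul_exp_neg_le hc hz.le j
        · exact pow_mul_exp_neg_le hc hz.le (j + 2)

theorem continuousOn_gaussFactor :
    ContinuousOn (fun p : ℝ × ℝ => gaussFactor p.1 p.2) (Ioi 0 ×ˢ Ioi 0) := by
  rintro ⟨τ, y⟩ ⟨hτ : 0 < τ, hy⟩
  refine ContinuousAt.continuousWithinAt ?_
  unfold gaussFactor
  have h1 : ContinuousAt (fun p : ℝ × ℝ => p.1 ^ (-(3 / 2) : ℝ)) (τ, y) :=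
    continuousAt_fst.rpow_const (Or.inl hτ.ne')
  have h2 : ContinuousAt (fun p : ℝ × ℝ => p.2 ^ 2 / (4 * p.1)) (τ, y) :=
    ContinuousAt.div (by fun_prop) (by fun_prop) (by simpa using hτ.ne')
  exact (continuousAt_const.mul h1).mul h2.neg.rexp

theorem isHalfLineKernel_boundaryKernel : IsHalfLineKernel boundaryKernel := by
  refine ⟨continuousOn_snd.mul continuousOn_gaussFactor, fun a b ha => ?_⟩
  obtain ⟨M, hM0, hM⟩ := exists_gaussFactor_div_pow_le ha 0
  refine ⟨b * M, fun τ hτ y hy => ?_⟩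
  have := hM τ hτ y hy.1
  have hy0 : 0 ≤ y := ha.le.trans hy.1
  rw [pow_zero, div_one] at this
  rw [boundaryKernel, abs_of_nonneg (mul_nonneg hy0 (gaussFactor_nonneg hτ y))]
  exact mul_le_mul hy.2 this (gaussFactor_nonneg hτ y) (hy0.trans hy.2)

theorem isHalfLineKernel_boundaryKernelDy : IsHalfLineKernel boundaryKernelDy := by
  constructor
  · refine ContinuousOn.mul (continuousOn_const.sub ?_) continuousOn_gaussFactor
    exact ContinuousOn.div (by fun_prop) (by fun_prop) fun p hp => by simpa using hp.1.ne'
  intro a b ha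
  obtain ⟨M₀, hM₀, h0⟩ := exists_gaussFactor_div_pow_le ha 0
  obtain ⟨M₁, hM₁, h1⟩ := exists_gaussFactor_div_pow_le ha 1
  refine ⟨M₀ + b ^ 2 / 2 * M₁, fun τ hτ y hy => ?_⟩
  have h0 := h0 τ hτ y hy.1
  have h1 := h1 τ hτ y hy.1
  have hy0 : 0 ≤ y := ha.le.trans hy.1
  have hg := gaussFactor_nonneg hτ y
  rw [pow_zero, div_one] at h0
  rw [pow_one] at h1
  calc |boundaryKernelDy τ y| = |gaussFactor τ y - y ^ 2 / 2 * (gaussFactor τ y / τ)| := by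
        congr 1
        unfold boundaryKernelDy
        field_simp
    _ ≤ |gaussFactor τ y| + |y ^ 2 / 2 * (gaussFactor τ y / τ)| := abs_sub _ _
    _ = gaussFactor τ y + y ^ 2 / 2 * (gaussFactor τ y / τ) := by
        rw [abs_of_nonneg hg, abs_of_nonneg (by positivity)]
    _ ≤ _ := by
        have := hy.2
        gcongr

theorem isHalfLineKernel_boundaryKernelDyy : IsHalfLineKernel boundaryKernelDyy := by
  constructor
  · refine ContinuousOn.mul (ContinuousOn.sub ?_ ?_) continuousOn_gaussFactor
    · exact ContinuousOn.div (by fun_prop) (by fun_prop) fun p hp => by simpa using hp.1.ne'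
    · exact ContinuousOn.div (by fun_prop) (by fun_prop) fun p hp => by simpa using hp.1.ne'
  intro a b ha
  obtain ⟨M₁, hM₁, h1⟩ := exists_gaussFactor_div_pow_le ha 1
  obtain ⟨M₂, hM₂, h2⟩ := exists_gaussFactor_div_pow_le ha 2
  refine ⟨b ^ 3 / 4 * M₂ + 3 * b / 2 * M₁, fun τ hτ y hy => ?_⟩
  have h1 := h1 τ hτ y hy.1
  have h2 := h2 τ hτ y hy.1
  have hy0 : 0 ≤ y := ha.le.trans hy.1
  have hg := gaussFactor_nonneg hτ y
  rw [pow_one] at h1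
  calc |boundaryKernelDyy τ y|
      = |y ^ 3 / 4 * (gaussFactor τ y / τ ^ 2) - 3 * y / 2 * (gaussFactor τ y / τ)| := by
        congr 1
        unfold boundaryKernelDyy
        field_simp
    _ ≤ |y ^ 3 / 4 * (gaussFactor τ y / τ ^ 2)| + |3 * y / 2 * (gaussFactor τ y / τ)| :=
        abs_sub _ _
    _ = y ^ 3 / 4 * (gaussFactor τ y / τ ^ 2) + 3 * y / 2 * (gaussFactor τ y / τ) := by
        rw [abs_of_nonneg (by positivity), abs_of_nonneg (by positivity)]
    _ ≤ _ := by
        have := hy.2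
        have := hy0.trans hy.2
        gcongr

theorem tendsto_boundaryKernel_zero {y : ℝ} (hy : 0 < y) :
    Tendsto (fun τ => boundaryKernel τ y) (𝓝[>] 0) (𝓝 0) := by
  obtain ⟨M, hM0, hM⟩ := exists_gaussFactor_div_pow_le hy 1
  have h : Tendsto (fun τ : ℝ => y * (M * τ)) (𝓝[>] 0) (𝓝 0) := by
    have : Tendsto (fun τ : ℝ => y * (M * τ)) (𝓝 0) (𝓝 (y * (M * 0))) :=
      Continuous.tendsto (by fun_prop) 0
    simpa using this.mono_left nhdsWithin_le_nhds
  refine squeeze_zero' ?_ ?_ h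
  · filter_upwards [self_mem_nhdsWithin] with τ hτ
    exact mul_nonneg hy.le (gaussFactor_nonneg hτ y)
  · filter_upwards [self_mem_nhdsWithin] with τ hτ
    have := hM τ hτ y le_rfl
    rw [pow_one, div_le_iff₀ hτ] at this
    exact mul_le_mul_of_nonneg_left this hy.le

end
-- The half line solution: boundary values, contraction, derivatives.
section
open MeasureTheory Filter Topology

variable {δ : ℝ} {φ ψ : ℝ → ℝ}

/-- The solution of the heat equation on the half line `y ≥ 0` with boundary datum `φ`. -/
noncomputable def halfLineSolution (φ : ℝ → ℝ) (t y : ℝ) : ℝ :=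
  2 / Real.sqrt Real.pi *
    ∫ σ in Ioi (0 : ℝ), φ (t - (y / (2 * σ)) ^ 2) * Real.exp (-σ ^ 2)

theorem integrable_exp_neg_sq : Integrable (fun σ : ℝ => Real.exp (-σ ^ 2)) := by
  simpa using integrable_exp_neg_mul_sq (b := 1) one_pos

theorem integral_Ioi_exp_neg_sq :
    ∫ σ in Ioi (0 : ℝ), Real.exp (-σ ^ 2) = Real.sqrt Real.pi / 2 := by
  simpa using integral_gaussian_Ioi 1

theorem halfLineSolution_zero (φ : ℝ → ℝ) (t : ℝ) : halfLineSolution φ t 0 = φ t := by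
  have : Real.sqrt Real.pi ≠ 0 := (Real.sqrt_pos.2 Real.pi_pos).ne'
  simp only [halfLineSolution, zero_div, zero_pow two_ne_zero, sub_zero]
  rw [integral_const_mul, integral_Ioi_exp_neg_sq]
  field_simp

theorem aestronglyMeasurable_halfLine (hφ : Continuous φ) (t y : ℝ) :
    AEStronglyMeasurable (fun σ => φ (t - (y / (2 * σ)) ^ 2) * Real.exp (-σ ^ 2))
      (volume.restrict (Ioi 0)) := by
  refine ContinuousOn.aestronglyMeasurable ?_ measurableSet_Ioi
  refine ContinuousOn.mul (hφ.comp_continuousOn ?_) (by fun_prop)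
  refine continuousOn_const.sub (ContinuousOn.pow (continuousOn_const.div (by fun_prop) ?_) 2)
  intro σ hσ
  simpa using (ne_of_gt hσ : σ ≠ 0)

theorem integrableOn_halfLine (hφ : Continuous φ) {K T : ℝ} (hK : ∀ t ≤ T, |φ t| ≤ K)
    {t : ℝ} (ht : t ≤ T) (y : ℝ) :
    IntegrableOn (fun σ => φ (t - (y / (2 * σ)) ^ 2) * Real.exp (-σ ^ 2)) (Ioi 0) := by
  refine (integrable_exp_neg_sq.integrableOn.const_mul K).mono'
    (aestronglyMeasurable_halfLine hφ t y) (ae_of_all _ fun σ => ?_)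
  rw [norm_mul, Real.norm_of_nonneg (Real.exp_pos _).le]
  gcongr
  exact hK _ (by nlinarith [sq_nonneg (y / (2 * σ))])

/-- In the variable `σ = y / (2 √τ)` the kernel is a fixed Gaussian and `y` enters only through the
argument of `φ`. The singularity at `y = 0` disappears, so continuity holds up to the boundary by
dominated convergence. -/
theorem continuous_halfLineSolution (hφ : Continuous φ)
    (hb : ∀ T : ℝ, ∃ K : ℝ, ∀ t ≤ T, |φ t| ≤ K) :
    Continuous (fun p : ℝ × ℝ => halfLineSolution φ p.1 p.2) := by
  refine continuous_const.mul (continuous_iff_continuousAt.2 fun p₀ => ?_)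
  obtain ⟨K, hK⟩ := hb (p₀.1 + 1)
  have hnhds : ∀ᶠ p : ℝ × ℝ in 𝓝 p₀, p.1 ≤ p₀.1 + 1 :=
    (continuous_fst.tendsto _).eventually (Iic_mem_nhds (lt_add_one _))
  refine continuousAt_of_dominated (bound := fun σ => K * Real.exp (-σ ^ 2)) ?_ ?_
    (integrable_exp_neg_sq.integrableOn.const_mul K) ?_
  · exact Eventually.of_forall fun p => aestronglyMeasurable_halfLine hφ p.1 p.2
  · filter_upwards [hnhds] with p hp
    refine ae_of_all _ fun σ => ?_
    rw [norm_mul, Real.norm_of_nonneg (Real.exp_pos _).le]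
    gcongr
    exact hK _ (by nlinarith [sq_nonneg (p.2 / (2 * σ))])
  · refine ae_of_all _ fun σ => Continuous.continuousAt ?_
    exact (hφ.comp (by fun_prop)).mul_const _

theorem halfLineSolution_eq_kernelIntegral (φ : ℝ → ℝ) (t : ℝ) {y : ℝ} (hy : 0 < y) :
    halfLineSolution φ t y = kernelIntegral boundaryKernel φ t y := by
  set f : ℝ → ℝ := fun σ => φ (t - (y / (2 * σ)) ^ 2) * Real.exp (-σ ^ 2) with hf
  -- The substitution `σ = (y/2) τ^(-1/2)` is made in two steps: a scaling by `y/2`, then the power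
  -- `-1/2`.
  have h1 := integral_comp_mul_left_Ioi' f 0 (half_pos hy)
  have h2 := integral_comp_rpow_Ioi (fun x => f (y / 2 * x)) (p := -(1 / 2)) (by norm_num)
  rw [mul_zero] at h1
  rw [halfLineSolution, ← hf, ← h1, ← h2, smul_eq_mul, ← integral_const_mul,
    ← integral_const_mul, kernelIntegral]
  refine setIntegral_congr_fun measurableSet_Ioi fun τ (hτ : 0 < τ) => ?_
  have hs : (τ ^ (-(1 / 2) : ℝ)) ^ 2 = τ⁻¹ := by
    rw [← Real.rpow_natCast, ← Real.rpow_mul hτ.le]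
    norm_num
    exact Real.rpow_neg_one τ
  have hp : 0 < τ ^ (-(1 / 2) : ℝ) := Real.rpow_pos_of_pos hτ _
  have e1 : (y / (2 * (y / 2 * τ ^ (-(1 / 2) : ℝ)))) ^ 2 = τ := by
    rw [show y / (2 * (y / 2 * τ ^ (-(1 / 2) : ℝ))) = (τ ^ (-(1 / 2) : ℝ))⁻¹ by field_simp,
      inv_pow, hs, inv_inv]
  have e2 : -(y / 2 * τ ^ (-(1 / 2) : ℝ)) ^ 2 = -(y ^ 2 / (4 * τ)) := by
    rw [mul_pow, hs]
    field_simp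
    norm_num
  simp only [hf, e1, e2, boundaryKernel, gaussFactor, smul_eq_mul]
  rw [show (-(1 / 2) - 1 : ℝ) = -(3 / 2) by norm_num, abs_neg, abs_of_pos (by norm_num)]
  field_simp

theorem HasExpDecay.bounded (hδ : 0 < δ) (hφ : HasExpDecay δ φ) (T : ℝ) :
    ∃ K : ℝ, ∀ t ≤ T, |φ t| ≤ K := by
  obtain ⟨K, hK0, hK⟩ := hφ.exists_bound hδ T
  exact ⟨K, fun t ht => by simpa using hK t ht 0 le_rfl⟩

theorem HasExpDecay.continuous_halfLineSolution (hδ : 0 < δ) (hφ : HasExpDecay δ φ) :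
    Continuous (fun p : ℝ × ℝ => halfLineSolution φ p.1 p.2) :=
  _root_.continuous_halfLineSolution hφ.continuous (hφ.bounded hδ)

/-- The factor by which the half line solution operator contracts the norm with weight
`exp (δ t)`. -/
noncomputable def contractionFactor (δ y : ℝ) : ℝ :=
  2 / Real.sqrt Real.pi *
    ∫ σ in Ioi (0 : ℝ), Real.exp (-(δ * (y / (2 * σ)) ^ 2)) * Real.exp (-σ ^ 2)

theorem integrableOn_contractionFactor (hδ : 0 < δ) (y : ℝ) :
    IntegrableOn (fun σ => Real.exp (-(δ * (y / (2 * σ)) ^ 2)) * Real.exp (-σ ^ 2)) (Ioi 0) := by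
  have := integrableOn_halfLine (φ := fun s => Real.exp (δ * s)) (K := 1) (T := 0) (by fun_prop)
    (fun t ht => by
      rw [abs_of_pos (Real.exp_pos _)]
      exact Real.exp_le_one_iff.2 (mul_nonpos_of_nonneg_of_nonpos hδ.le ht)) le_rfl y
  simpa using this

theorem contractionFactor_nonneg (δ y : ℝ) : 0 ≤ contractionFactor δ y := by
  unfold contractionFactor
  positivity

/-- The integrand is strictly below the Gaussian `exp (-σ²)`, whose normalised integral is `1`. -/
theorem contractionFactor_lt_one (hδ : 0 < δ) {y : ℝ} (hy : 0 < y) :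
    contractionFactor δ y < 1 := by
  have hpi : 0 < Real.sqrt Real.pi := Real.sqrt_pos.2 Real.pi_pos
  have hint := integrableOn_contractionFactor hδ y
  have hpos : 0 < ∫ σ in Ioi (0 : ℝ), (Real.exp (-σ ^ 2) -
      Real.exp (-(δ * (y / (2 * σ)) ^ 2)) * Real.exp (-σ ^ 2)) := by
    have hlt : ∀ σ > (0 : ℝ), 0 < Real.exp (-σ ^ 2) -
        Real.exp (-(δ * (y / (2 * σ)) ^ 2)) * Real.exp (-σ ^ 2) := fun σ hσ => by
      have h1 : Real.exp (-(δ * (y / (2 * σ)) ^ 2)) < 1 := Real.exp_lt_one_iff.2 (by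
        rw [neg_lt_zero]
        positivity)
      nlinarith [Real.exp_pos (-σ ^ 2)]
    rw [setIntegral_pos_iff_support_of_nonneg_ae (f := fun σ => Real.exp (-σ ^ 2) -
      Real.exp (-(δ * (y / (2 * σ)) ^ 2)) * Real.exp (-σ ^ 2)) ?_
      (integrable_exp_neg_sq.integrableOn.sub hint)]
    · have hsub : Ioi (0 : ℝ) ⊆ Function.support (fun σ => Real.exp (-σ ^ 2) -
          Real.exp (-(δ * (y / (2 * σ)) ^ 2)) * Real.exp (-σ ^ 2)) ∩ Ioi 0 :=
        fun σ hσ => ⟨(hlt σ hσ).ne', hσ⟩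
      refine lt_of_lt_of_le ?_ (measure_mono hsub)
      simp
    · exact (ae_restrict_iff' measurableSet_Ioi).2 (ae_of_all _ fun σ hσ => (hlt σ hσ).le)
  rw [integral_sub integrable_exp_neg_sq.integrableOn hint, integral_Ioi_exp_neg_sq,
    sub_pos] at hpos
  calc contractionFactor δ y < 2 / Real.sqrt Real.pi * (Real.sqrt Real.pi / 2) :=
        mul_lt_mul_of_pos_left hpos (by positivity)
    _ = 1 := by field_simp

/-- A delay `(y/(2σ))²` in the datum costs exactly `exp (-(δ (y/(2σ))²))` in the weighted norm. -/
theorem abs_halfLineSolution_le (hδ : 0 < δ) {K T : ℝ}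
    (hK : ∀ t ≤ T, |φ t| ≤ K * Real.exp (δ * t)) {t : ℝ} (ht : t ≤ T) (y : ℝ) :
    |halfLineSolution φ t y| ≤ contractionFactor δ y * K * Real.exp (δ * t) := by
  have h := norm_integral_le_of_norm_le (μ := volume.restrict (Ioi 0))
    (f := fun σ => φ (t - (y / (2 * σ)) ^ 2) * Real.exp (-σ ^ 2))
    ((integrableOn_contractionFactor hδ y).const_mul (K * Real.exp (δ * t)))
    (ae_of_all _ fun σ => ?_)
  · rw [integral_const_mul] at h
    rw [halfLineSolution, abs_mul, abs_of_nonneg (by positivity), contractionFactor]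
    calc _ ≤ 2 / Real.sqrt Real.pi * _ := mul_le_mul_of_nonneg_left h (by positivity)
      _ = _ := by ring
  · rw [norm_mul, Real.norm_of_nonneg (Real.exp_pos _).le, ← mul_assoc]
    gcongr
    refine (hK _ (by nlinarith [sq_nonneg (y / (2 * σ))])).trans_eq ?_
    rw [mul_assoc, ← Real.exp_add]
    ring_nf

theorem HasExpDecay.comp_halfLineSolution (hδ : 0 < δ) (hφ : HasExpDecay δ φ) (y : ℝ) :
    HasExpDecay δ (fun t => halfLineSolution φ t y) := by
  refine ⟨(hφ.continuous_halfLineSolution hδ).comp (by fun_prop : Continuous fun t => (t, y)),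
    fun T => ?_⟩
  obtain ⟨K, hK⟩ := hφ.bound T
  exact ⟨contractionFactor δ y * K, fun t ht => abs_halfLineSolution_le hδ hK ht y⟩

/-- The kernel satisfies the heat equation, so its second space derivative is its `τ`-derivative,
and integration by parts in `τ` moves it to the datum. The boundary terms vanish: the kernel tends
to `0` as `τ → 0` for `y > 0`, and the datum decays as `τ → ∞`. -/
theorem kernelIntegral_Dyy_of_hasDerivAt (hδ : 0 < δ) {Φ : ℝ → ℝ}
    (hΦ : HasExpDecay δ Φ) (hφ : HasExpDecay δ φ) (hΦφ : ∀ t, HasDerivAt Φ (φ t) t)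
    (t : ℝ) {y : ℝ} (hy : 0 < y) :
    kernelIntegral boundaryKernelDyy Φ t y = kernelIntegral boundaryKernel φ t y := by
  have hv : ∀ τ ∈ Ioi (0 : ℝ), HasDerivAt (fun τ => Φ (t - τ)) (-φ (t - τ)) τ := fun τ _ =>
    (hΦφ (t - τ)).comp_const_sub t τ
  have h := integral_Ioi_mul_deriv_eq_deriv_mul (a := 0) (a' := 0) (b' := 0)
    (u := fun τ => boundaryKernel τ y) (v := fun τ => Φ (t - τ))
    (fun τ hτ => hasDerivAt_boundaryKernel_time hτ y) hv ?_
    (isHalfLineKernel_boundaryKernelDyy.integrableOn hδ hΦ t hy) ?_ ?_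
  · simp only [mul_neg, integral_neg, sub_zero, zero_sub, neg_inj] at h
    exact h.symm
  · have := (isHalfLineKernel_boundaryKernel.integrableOn hδ hφ t hy).neg
    refine this.congr_fun (fun _ _ => ?_) measurableSet_Ioi
    simp
  · have := (tendsto_boundaryKernel_zero hy).mul
      (((hΦ.continuous.comp (by fun_prop : Continuous fun τ => t - τ)).tendsto 0).mono_left
        nhdsWithin_le_nhds)
    rwa [zero_mul] at this
  · obtain ⟨K, hK⟩ := isHalfLineKernel_boundaryKernel.exists_dominated hδ hΦ t y hy
    have hlim : Tendsto (fun τ : ℝ => K * Real.exp (-δ * τ)) atTop (𝓝 (K * 0)) := by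
      refine (Real.tendsto_exp_atBot.comp ?_).const_mul K
      exact tendsto_id.const_mul_atTop_of_neg (neg_lt_zero.2 hδ)
    rw [mul_zero] at hlim
    refine squeeze_zero_norm' ?_ hlim
    filter_upwards [eventually_gt_atTop 0] with τ hτ using hK t le_rfl y ⟨le_rfl, le_rfl⟩ τ hτ

/-- The datum is only continuous, so it cannot be differentiated. It is written as the derivative of
its primitive from `-∞`; one time derivative then turns the primitive back into `φ` while the kernel
keeps its two space derivatives. -/
theorem hasDerivAt_halfLineSolution_time (hδ : 0 < δ) (hφ : HasExpDecay δ φ) (t : ℝ)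
    {y : ℝ} (hy : 0 < y) :
    HasDerivAt (fun s => halfLineSolution φ s y) (kernelIntegral boundaryKernelDyy φ t y) t := by
  have h : (fun s => halfLineSolution φ s y) =
      fun s => kernelIntegral boundaryKernelDyy (primitiveFromBot φ) s y := by
    ext s
    rw [halfLineSolution_eq_kernelIntegral φ s hy, kernelIntegral_Dyy_of_hasDerivAt hδ
      (hφ.primitive hδ) hφ (hφ.hasDerivAt_primitive hδ) s hy]
  rw [h]
  exact hasDerivAt_kernelIntegral_time hδ isHalfLineKernel_boundaryKernelDyy (hφ.primitive hδ)
    hφ (hφ.hasDerivAt_primitive hδ) t hy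

theorem hasDerivAt_halfLineSolution_space (hδ : 0 < δ) (hφ : HasExpDecay δ φ) (t : ℝ)
    {y : ℝ} (hy : 0 < y) :
    HasDerivAt (fun z => halfLineSolution φ t z) (kernelIntegral boundaryKernelDy φ t y) y := by
  refine (hasDerivAt_kernelIntegral_space hδ isHalfLineKernel_boundaryKernel
    isHalfLineKernel_boundaryKernelDy (fun τ hτ y _ => hasDerivAt_boundaryKernel_space hτ y)
    hφ t hy).congr_of_eventuallyEq ?_
  filter_upwards [Ioi_mem_nhds hy] with z hz using halfLineSolution_eq_kernelIntegral φ t hz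

theorem hasDerivAt_kernelIntegral_Dy (hδ : 0 < δ) (hφ : HasExpDecay δ φ) (t : ℝ)
    {y : ℝ} (hy : 0 < y) :
    HasDerivAt (fun z => kernelIntegral boundaryKernelDy φ t z)
      (kernelIntegral boundaryKernelDyy φ t y) y :=
  hasDerivAt_kernelIntegral_space hδ isHalfLineKernel_boundaryKernelDy
    isHalfLineKernel_boundaryKernelDyy (fun _ hτ y _ => hasDerivAt_boundaryKernelDy_space hτ y)
    hφ t hy

end
-- Regularity up to the boundary for `C¹` data.
section
open MeasureTheory Filter Topology

variable {δ : ℝ} {φ φ' ψ : ℝ → ℝ}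

/-- The constants in `HasExpDecay` depend on `T`, so compactness of `[a,T]` suffices and behaviour
at `+∞` is irrelevant. -/
theorem hasExpDecay_of_eq_zero (hδ : 0 < δ) (hψ : Continuous ψ) {a : ℝ}
    (h0 : ∀ t ≤ a, ψ t = 0) : HasExpDecay δ ψ := by
  refine ⟨hψ, fun T => ?_⟩
  obtain ⟨M, hM⟩ := isCompact_Icc.exists_bound_of_continuousOn (s := Icc a T) hψ.continuousOn
  refine ⟨|M| * Real.exp (-(δ * a)), fun t ht => ?_⟩
  rcases le_total t a with h | h
  · rw [h0 t h, abs_zero]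
    positivity
  · rw [mul_assoc, ← Real.exp_add]
    have h1 : 1 ≤ Real.exp (-(δ * a) + δ * t) := Real.one_le_exp (by nlinarith)
    have h2 : |ψ t| ≤ |M| := (hM t ⟨h, ht⟩).trans (le_abs_self M)
    exact h2.trans (le_mul_of_one_le_right (abs_nonneg M) h1)

theorem HasExpDecay.sub (hφ : HasExpDecay δ φ) (hψ : HasExpDecay δ ψ) :
    HasExpDecay δ (fun t => φ t - ψ t) := by
  refine ⟨hφ.continuous.sub hψ.continuous, fun T => ?_⟩
  obtain ⟨K, hK⟩ := hφ.bound T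
  obtain ⟨L, hL⟩ := hψ.bound T
  refine ⟨K + L, fun t ht => (abs_sub _ _).trans ?_⟩
  rw [add_mul]
  exact add_le_add (hK t ht) (hL t ht)

theorem abs_boundaryKernelDyy_le {τ y : ℝ} (hτ : 1 ≤ τ) (hy : 0 ≤ y) :
    |boundaryKernelDyy τ y| ≤ (y ^ 3 / 4 + 3 * y / 2) * (2 * Real.sqrt Real.pi)⁻¹ := by
  have hτ0 : 0 < τ := by linarith
  have hg := gaussFactor_nonneg hτ0 y
  have h1 : gaussFactor τ y ≤ (2 * Real.sqrt Real.pi)⁻¹ := by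
    unfold gaussFactor
    rw [mul_assoc]
    refine mul_le_of_le_one_right (by positivity) ?_
    refine mul_le_one₀ (Real.rpow_le_one_of_one_le_of_nonpos hτ (by norm_num))
      (Real.exp_pos _).le (Real.exp_le_one_iff.2 ?_)
    rw [neg_nonpos]
    positivity
  unfold boundaryKernelDyy
  rw [abs_mul, abs_of_nonneg hg]
  refine mul_le_mul ((abs_sub _ _).trans ?_) h1 hg (by positivity)
  rw [abs_of_nonneg (by positivity), abs_of_nonneg (by positivity)]
  refine add_le_add ?_ ?_
  · exact div_le_div_of_nonneg_left (by positivity) (by norm_num) (by nlinarith)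
  · exact div_le_div_of_nonneg_left (by positivity) (by norm_num) (by nlinarith)

/-- If the datum stopped one unit of time ago, only `τ ≥ 1` contributes, where the kernel is
nonsingular and vanishes with `y`. Hence the distant past has no influence in the limit `y → 0`. -/
theorem abs_kernelIntegral_Dyy_le (hδ : 0 < δ) (hψ : HasExpDecay δ ψ) {T : ℝ}
    (h0 : ∀ t ≥ T, ψ t = 0) (T' : ℝ) :
    ∃ K : ℝ, ∀ t ∈ Icc (T + 1) T', ∀ y ≥ 0,
      |kernelIntegral boundaryKernelDyy ψ t y| ≤ K * (y ^ 3 / 4 + 3 * y / 2) := by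
  obtain ⟨K, hK0, hK⟩ := hψ.exists_bound hδ T'
  refine ⟨(2 * Real.sqrt Real.pi)⁻¹ * ∫ τ in Ioi (0 : ℝ), K * Real.exp (-δ * τ),
    fun t ht y hy => ?_⟩
  have h := norm_integral_le_of_norm_le (μ := volume.restrict (Ioi 0))
    (f := fun τ => boundaryKernelDyy τ y * ψ (t - τ))
    ((integrableOn_exp_neg_mul hδ K).const_mul
      ((y ^ 3 / 4 + 3 * y / 2) * (2 * Real.sqrt Real.pi)⁻¹)) ?_
  · rw [integral_const_mul] at h
    refine h.trans_eq ?_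
    ring
  · refine (ae_restrict_iff' measurableSet_Ioi).2 (ae_of_all _ fun τ (hτ : 0 < τ) => ?_)
    rcases le_total τ 1 with h1 | h1
    · rw [h0 (t - τ) (by linarith [ht.1]), mul_zero, norm_zero]
      positivity
    · rw [norm_mul]
      exact mul_le_mul (abs_boundaryKernelDyy_le h1 hy) (hK t ht.2 τ hτ.le) (abs_nonneg _)
        (by positivity)

/-- The second space derivative of the half line solution, extended to the boundary `y = 0` by
the derivative `φ'` of the boundary datum. -/
noncomputable def halfLineDyy (φ φ' : ℝ → ℝ) (t y : ℝ) : ℝ :=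
  if 0 < y then kernelIntegral boundaryKernelDyy φ t y else φ' t

theorem continuousOn_halfLineDyy (hδ : 0 < δ) (hφ : HasExpDecay δ φ)
    (hφφ' : ∀ t, HasDerivAt φ (φ' t) t) (hφ' : Continuous φ') :
    ContinuousOn (fun p : ℝ × ℝ => halfLineDyy φ φ' p.1 p.2) (univ ×ˢ Ici 0) := by
  rintro ⟨t₀, y₀⟩ ⟨-, hy₀ : 0 ≤ y₀⟩
  rcases hy₀.lt_or_eq with hy₀ | rfl
  · have hn : (univ : Set ℝ) ×ˢ Ioi (0 : ℝ) ∈ 𝓝 (t₀, y₀) :=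
      (isOpen_univ.prod isOpen_Ioi).mem_nhds ⟨trivial, hy₀⟩
    have h := (continuousOn_kernelIntegral hδ isHalfLineKernel_boundaryKernelDyy hφ).continuousAt hn
    refine (h.congr ?_).continuousWithinAt
    filter_upwards [hn] with p hp
    exact (if_pos hp.2).symm
  -- At a boundary point, `φ` is split by a cutoff that is `0` before `t₀ - 3` and `1` after `t₀ -
  -- 2`. Nothing is assumed on the decay of `φ'`, so only the recent part `φ η` is integrated by
  -- parts: it contributes `Gψ`, continuous up to `y = 0`. The old part `φ - φ η` contributes a term
  -- that vanishes as `y → 0`.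
  set η : ℝ → ℝ := fun s => Real.smoothTransition (s - (t₀ - 3)) with hη
  have hηd : ContDiff ℝ 1 η := Real.smoothTransition.contDiff.comp (by fun_prop)
  have hη0 : ∀ s ≤ t₀ - 3, η s = 0 := fun s hs =>
    Real.smoothTransition.zero_of_nonpos (by linarith)
  have hη1 : ∀ s ≥ t₀ - 2, η s = 1 := fun s hs =>
    Real.smoothTransition.one_of_one_le (by linarith)
  have hη' : Continuous (deriv η) := hηd.continuous_deriv le_rfl
  have hηder : ∀ s, HasDerivAt η (deriv η s) s := fun s =>
    (hηd.differentiable one_ne_zero s).hasDerivAt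
  have hη'0 : ∀ s ≤ t₀ - 4, deriv η s = 0 := fun s hs => by
    have : η =ᶠ[𝓝 s] fun _ => 0 := by
      filter_upwards [Iic_mem_nhds (by linarith : s < t₀ - 3)] with r hr using hη0 r hr
    rw [this.deriv_eq, deriv_const]
  have hη'1 : deriv η t₀ = 0 := by
    have : η =ᶠ[𝓝 t₀] fun _ => 1 := by
      filter_upwards [Ici_mem_nhds (by linarith : t₀ - 2 < t₀)] with r hr using hη1 r hr
    rw [this.deriv_eq, deriv_const]
  set ψ : ℝ → ℝ := fun s => φ' s * η s + φ s * deriv η s with hψ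
  have hφ₁ : HasExpDecay δ (fun s => φ s * η s) :=
    hasExpDecay_of_eq_zero hδ (hφ.continuous.mul hηd.continuous) (a := t₀ - 3)
      fun s hs => by rw [hη0 s hs, mul_zero]
  have hψ₁ : HasExpDecay δ ψ :=
    hasExpDecay_of_eq_zero hδ ((hφ'.mul hηd.continuous).add (hφ.continuous.mul hη'))
      (a := t₀ - 4) fun s hs => by
        simp only [hψ, hη0 s (by linarith), hη'0 s hs, mul_zero, add_zero]
  have hder : ∀ s, HasDerivAt (fun s => φ s * η s) (ψ s) s := fun s => (hφφ' s).mul (hηder s)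
  have hφ₂ := hφ.sub hφ₁
  obtain ⟨K, hK⟩ := abs_kernelIntegral_Dyy_le hδ hφ₂ (T := t₀ - 2)
    (fun s hs => by rw [hη1 s hs, mul_one, sub_self]) (t₀ + 1)
  have hsplit : ∀ t : ℝ, ∀ y > 0, kernelIntegral boundaryKernelDyy φ t y =
      halfLineSolution ψ t y +
        kernelIntegral boundaryKernelDyy (fun s => φ s - φ s * η s) t y := by
    intro t y hy
    rw [halfLineSolution_eq_kernelIntegral ψ t hy,
      ← kernelIntegral_Dyy_of_hasDerivAt hδ hφ₁ hψ₁ hder t hy]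
    unfold kernelIntegral
    rw [← integral_add (isHalfLineKernel_boundaryKernelDyy.integrableOn hδ hφ₁ t hy)
      (isHalfLineKernel_boundaryKernelDyy.integrableOn hδ hφ₂ t hy)]
    congr 1 with τ
    ring
  set R : ℝ × ℝ → ℝ := fun p => halfLineDyy φ φ' p.1 p.2 - halfLineSolution ψ p.1 p.2 with hR
  have hmain : Tendsto R (𝓝[univ ×ˢ Ici 0] (t₀, 0)) (𝓝 0) := by
    -- The first summand bounds `R` at points with `y > 0`, the second at points with `y = 0`; near
    -- `t₀` the function `ψ` agrees with `φ'`.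
    have hlim : Tendsto (fun p : ℝ × ℝ => K * (p.2 ^ 3 / 4 + 3 * p.2 / 2) +
        |φ' p.1 - ψ p.1|) (𝓝[univ ×ˢ Ici 0] (t₀, 0)) (𝓝 0) := by
      have hc : Continuous (fun p : ℝ × ℝ => K * (p.2 ^ 3 / 4 + 3 * p.2 / 2) +
          |φ' p.1 - ψ p.1|) := by
        have := hψ₁.continuous
        fun_prop
      have := (hc.tendsto (t₀, 0)).mono_left (nhdsWithin_le_nhds (s := univ ×ˢ Ici 0))
      simpa [hψ, hη1 t₀ (by linarith), hη'1] using this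
    refine squeeze_zero_norm' ?_ hlim
    have hn : ∀ᶠ p : ℝ × ℝ in 𝓝 (t₀, (0 : ℝ)), p.1 ∈ Icc (t₀ - 1) (t₀ + 1) :=
      (continuous_fst.tendsto _).eventually (Icc_mem_nhds (by simp) (by simp))
    filter_upwards [nhdsWithin_le_nhds hn, self_mem_nhdsWithin] with p hp hp2
    rcases (show 0 ≤ p.2 from hp2.2).lt_or_eq with hy | hy
    · have := hK p.1 ⟨by linarith [hp.1], hp.2⟩ p.2 hy.le
      simp only [hR, halfLineDyy, if_pos hy, hsplit p.1 p.2 hy, add_sub_cancel_left,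
        Real.norm_eq_abs]
      linarith [abs_nonneg (φ' p.1 - ψ p.1)]
    · simp [hR, halfLineDyy, ← hy, halfLineSolution_zero]
  have hG := ((hψ₁.continuous_halfLineSolution hδ).tendsto (t₀, 0)).mono_left
    (nhdsWithin_le_nhds (s := univ ×ˢ Ici 0))
  have := hmain.add hG
  simp only [hR, sub_add_cancel, zero_add, halfLineSolution_zero] at this
  have hval : halfLineDyy φ φ' t₀ 0 = ψ t₀ := by
    simp [halfLineDyy, hψ, hη1 t₀ (by linarith), hη'1]
  rw [ContinuousWithinAt, hval]
  exact this

/-- The half line solution with datum `φ` satisfies the heat equation for `y ∈ Y`, with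
continuous derivatives. -/
def IsHeatRegularOn (φ : ℝ → ℝ) (Y : Set ℝ) : Prop :=
  ∃ Gy Gyy : ℝ → ℝ → ℝ,
    ContinuousOn (fun p : ℝ × ℝ => Gy p.1 p.2) (univ ×ˢ Y) ∧
    ContinuousOn (fun p : ℝ × ℝ => Gyy p.1 p.2) (univ ×ˢ Y) ∧
    ∀ t, ∀ y ∈ Y, HasDerivAt (fun s => halfLineSolution φ s y) (Gyy t y) t ∧
      HasDerivWithinAt (fun z => halfLineSolution φ t z) (Gy t y) Y y ∧
      HasDerivWithinAt (fun z => Gy t z) (Gyy t y) Y y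

theorem HasExpDecay.isHeatRegularOn_Ioi (hδ : 0 < δ) (hφ : HasExpDecay δ φ) :
    IsHeatRegularOn φ (Ioi 0) :=
  ⟨kernelIntegral boundaryKernelDy φ, kernelIntegral boundaryKernelDyy φ,
    continuousOn_kernelIntegral hδ isHalfLineKernel_boundaryKernelDy hφ,
    continuousOn_kernelIntegral hδ isHalfLineKernel_boundaryKernelDyy hφ, fun t _ hy =>
    ⟨hasDerivAt_halfLineSolution_time hδ hφ t hy,
      (hasDerivAt_halfLineSolution_space hδ hφ t hy).hasDerivWithinAt,
      (hasDerivAt_kernelIntegral_Dy hδ hφ t hy).hasDerivWithinAt⟩⟩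

theorem HasExpDecay.isHeatRegularOn_Ici (hδ : 0 < δ) (hφ : HasExpDecay δ φ)
    (hφφ' : ∀ t, HasDerivAt φ (φ' t) t) (hφ' : Continuous φ') :
    IsHeatRegularOn φ (Ici 0) := by
  have hH := continuousOn_halfLineDyy hδ hφ hφφ' hφ'
  set H : ℝ → ℝ → ℝ := fun t y => halfLineDyy φ φ' t (max y 0) with hHdef
  have hHc : Continuous (Function.uncurry H) :=
    hH.comp_continuous (f := fun p : ℝ × ℝ => (p.1, max p.2 0)) (by fun_prop)
      fun p => by simp
  have hHt : ∀ t, Continuous (H t) := fun t => hHc.comp (by fun_prop : Continuous fun y => (t, y))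
  -- The first space derivative is recovered by integrating the second one from `y = 1`. It thus
  -- extends continuously to `y = 0` without a boundary estimate of its own.
  set D : ℝ → ℝ → ℝ := fun t y => kernelIntegral boundaryKernelDy φ t 1 + ∫ z in (1 : ℝ)..y, H t z
    with hD
  have hDder : ∀ t y, HasDerivAt (D t) (H t y) y := fun t y =>
    ((hHt t).integral_hasStrictDerivAt 1 y).hasDerivAt.const_add _
  have hDpos : ∀ t, ∀ y > 0, D t y = kernelIntegral boundaryKernelDy φ t y := by
    intro t y hy
    have : ∫ z in (1 : ℝ)..y, H t z = kernelIntegral boundaryKernelDy φ t y -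
        kernelIntegral boundaryKernelDy φ t 1 := by
      refine intervalIntegral.integral_eq_sub_of_hasDerivAt (fun z hz => ?_)
        ((hHt t).intervalIntegrable _ _)
      have hz0 : 0 < z := lt_of_lt_of_le (lt_min one_pos hy) hz.1
      have := hasDerivAt_kernelIntegral_Dy hδ hφ t hz0
      rwa [show H t z = kernelIntegral boundaryKernelDyy φ t z by
        simp only [hHdef, halfLineDyy, max_eq_left hz0.le, if_pos hz0]]
    rw [hD]
    simp only [this]
    ring
  have hspace : ∀ t, ∀ y > 0, HasDerivAt (fun z => halfLineSolution φ t z) (D t y) y :=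
    fun t y hy => by
      rw [hDpos t y hy]
      exact hasDerivAt_halfLineSolution_space hδ hφ t hy
  refine ⟨D, H, Continuous.continuousOn ?_, hHc.continuousOn, fun t y hy => ⟨?_, ?_,
    (hDder t y).hasDerivWithinAt⟩⟩
  · refine Continuous.add ?_ ?_
    · have := continuousOn_kernelIntegral hδ isHalfLineKernel_boundaryKernelDy hφ
      exact this.comp_continuous (f := fun p : ℝ × ℝ => (p.1, 1)) (by fun_prop)
        fun p => ⟨trivial, mem_Ioi.2 one_pos⟩
    · exact intervalIntegral.continuous_parametric_intervalIntegral_of_continuous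
        (f := fun (p : ℝ × ℝ) z => H p.1 z)
        (hHc.comp (by fun_prop : Continuous fun q : (ℝ × ℝ) × ℝ => (q.1.1, q.2))) continuous_snd
  · rcases (show 0 ≤ y from hy).lt_or_eq with hy | rfl
    · have := hasDerivAt_halfLineSolution_time hδ hφ t hy
      rwa [show H t y = kernelIntegral boundaryKernelDyy φ t y by
        simp only [hHdef, halfLineDyy, max_eq_left hy.le, if_pos hy]]
    · simpa [hHdef, halfLineDyy, halfLineSolution_zero] using hφφ' t
  · rcases (show 0 ≤ y from hy).lt_or_eq with hy | rfl
    · exact (hspace t y hy).hasDerivWithinAt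
    · refine hasDerivWithinAt_Ici_of_tendsto_deriv (s := Ioi 0)
        (fun z hz => (hspace t z hz).differentiableAt.differentiableWithinAt) ?_
        self_mem_nhdsWithin ?_
      · exact ((hφ.continuous_halfLineSolution hδ).comp
          (by fun_prop : Continuous fun z => (t, z))).continuousWithinAt
      · refine Tendsto.congr' ?_ ((hDder t 0).continuousAt.tendsto.mono_left nhdsWithin_le_nhds)
        filter_upwards [self_mem_nhdsWithin] with z hz using (hspace t z hz).deriv.symm

end
-- Reflection and existence on the strip.
section
open MeasureTheory Filter Topology

variable {δ : ℝ} {φ U : ℝ → ℝ}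

/-- The iterates of the operator that maps `U` to its half line solution at distance `2`. -/
noncomputable def iteratedReflection (U : ℝ → ℝ) : ℕ → ℝ → ℝ
  | 0 => U
  | n + 1 => fun t => halfLineSolution (iteratedReflection U n) t 2

theorem HasExpDecay.comp_iteratedReflection (hδ : 0 < δ) (hU : HasExpDecay δ U) (n : ℕ) :
    HasExpDecay δ (iteratedReflection U n) := by
  induction n with
  | zero => exact hU
  | succ n ih => exact ih.comp_halfLineSolution hδ 2

theorem abs_iteratedReflection_le (hδ : 0 < δ) {K T : ℝ}
    (hK : ∀ t ≤ T, |U t| ≤ K * Real.exp (δ * t)) (n : ℕ) :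
    ∀ t ≤ T, |iteratedReflection U n t| ≤
      contractionFactor δ 2 ^ n * K * Real.exp (δ * t) := by
  induction n with
  | zero => simpa [iteratedReflection] using hK
  | succ n ih =>
    intro t ht
    refine (abs_halfLineSolution_le hδ ih ht 2).trans_eq ?_
    ring

/-- Neumann series `φ = ∑ (-1)ⁿ Aⁿ U`, where `A` evaluates the half line solution at distance `2`.
It converges geometrically in the weighted norm, and dominated convergence lets `A` act term by
term. -/
theorem exists_add_halfLineSolution_eq (hδ : 0 < δ) (hU : HasExpDecay δ U) :
    ∃ φ : ℝ → ℝ, HasExpDecay δ φ ∧ ∀ t, φ t + halfLineSolution φ t 2 = U t := by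
  set q := contractionFactor δ 2 with hq
  have hq0 : 0 ≤ q := contractionFactor_nonneg δ 2
  have hq1 : q < 1 := contractionFactor_lt_one hδ two_pos
  have hgeom := summable_geometric_of_lt_one hq0 hq1
  set a := iteratedReflection U with ha
  set φ : ℝ → ℝ := fun t => ∑' n, (-1) ^ n * a n t with hφ
  have hbound : ∀ T, ∃ K, 0 ≤ K ∧ ∀ n, ∀ t ≤ T,
      ‖(-1) ^ n * a n t‖ ≤ q ^ n * (K * Real.exp (δ * t)) := by
    intro T
    obtain ⟨K, hK⟩ := hU.bound T
    have hK0 : 0 ≤ K := nonneg_of_mul_nonneg_left ((abs_nonneg _).trans (hK T le_rfl))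
      (Real.exp_pos _)
    refine ⟨K, hK0, fun n t ht => ?_⟩
    rw [norm_mul, norm_pow, norm_neg, norm_one, one_pow, one_mul, ← mul_assoc]
    exact abs_iteratedReflection_le hδ hK n t ht
  have hsummable : ∀ t, Summable fun n => (-1) ^ n * a n t := fun t => by
    obtain ⟨K, -, hK⟩ := hbound t
    exact Summable.of_norm_bounded (hgeom.mul_right _) fun n => hK n t le_rfl
  have hcont : Continuous φ := by
    refine continuous_iff_continuousAt.2 fun t => ?_
    obtain ⟨K, hK0, hK⟩ := hbound (t + 1)
    have : ContinuousOn φ (Iic (t + 1)) := by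
      refine continuousOn_tsum (u := fun n => q ^ n * (K * Real.exp (δ * (t + 1))))
        (fun n => (continuous_const.mul (hU.comp_iteratedReflection hδ n).continuous).continuousOn)
        (hgeom.mul_right _) fun n s hs => (hK n s hs).trans ?_
      have : s ≤ t + 1 := hs
      gcongr
    exact this.continuousAt (Iic_mem_nhds (lt_add_one t))
  refine ⟨φ, ⟨hcont, fun T => ?_⟩, fun t => ?_⟩
  · obtain ⟨K, -, hK⟩ := hbound T
    refine ⟨(1 - q)⁻¹ * K, fun t ht => ?_⟩
    have := tsum_of_norm_bounded ((hasSum_geometric_of_lt_one hq0 hq1).mul_right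
      (K * Real.exp (δ * t))) fun n => hK n t ht
    rwa [← mul_assoc] at this
  · obtain ⟨K, hK0, hK⟩ := hbound t
    have hint : HasSum
        (fun n => ∫ σ in Ioi (0 : ℝ),
          (-1) ^ n * a n (t - (2 / (2 * σ)) ^ 2) * Real.exp (-σ ^ 2))
        (∫ σ in Ioi (0 : ℝ), φ (t - (2 / (2 * σ)) ^ 2) * Real.exp (-σ ^ 2)) := by
      refine hasSum_integral_of_dominated_convergence
        (fun n σ => q ^ n * (K * Real.exp (δ * t)) * Real.exp (-σ ^ 2)) (fun n => ?_)
        (fun n => ae_of_all _ fun σ => ?_) (ae_of_all _ fun σ => ?_) ?_ (ae_of_all _ fun σ => ?_)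
      · exact aestronglyMeasurable_halfLine
          (continuous_const.mul (hU.comp_iteratedReflection hδ n).continuous) t 2
      · rw [norm_mul, Real.norm_of_nonneg (Real.exp_pos _).le]
        have h0 : t - (2 / (2 * σ)) ^ 2 ≤ t := by nlinarith [sq_nonneg (2 / (2 * σ))]
        gcongr
        exact (hK n _ h0).trans (by gcongr)
      · exact (hgeom.mul_right _).mul_right _
      · simp_rw [tsum_mul_right]
        exact integrable_exp_neg_sq.integrableOn.const_mul _
      · exact (hsummable _).hasSum.mul_right _
    have hA : halfLineSolution φ t 2 = ∑' n, (-1) ^ n * a (n + 1) t := by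
      rw [halfLineSolution, ← hint.tsum_eq, ← tsum_mul_left]
      congr 1 with n
      simp_rw [mul_assoc ((-1 : ℝ) ^ n), integral_const_mul]
      rw [mul_left_comm]
      rfl
    have hφt : φ t = U t + ∑' n, (-1) ^ (n + 1) * a (n + 1) t := by
      rw [hφ]
      simp only
      rw [(hsummable t).tsum_eq_zero_add]
      simp [ha, iteratedReflection]
    rw [hφt, hA]
    simp_rw [pow_succ, mul_neg_one, neg_mul, tsum_neg]
    ring

/-- The solution on `0 ≤ l ≤ 1` obtained from half line solutions with sources at `l = 1` and
`l = -1`. -/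
noncomputable def stripSolution (φ : ℝ → ℝ) (t l : ℝ) : ℝ :=
  halfLineSolution φ t (1 - l) + halfLineSolution φ t (1 + l)

/-- The set `Y` of admissible distances treats both cases together: `Y = (0,∞)` for `S = [0,1)`, and
`Y = [0,∞)` for `S = [0,1]`. -/
theorem isHeatSolution_stripSolution (hδ : 0 < δ) (hφ : HasExpDecay δ φ) {S Y : Set ℝ}
    (hY : IsHeatRegularOn φ Y) (hS₁ : ∀ l ∈ S, 1 - l ∈ Y) (hS₂ : ∀ l ∈ S, 1 + l ∈ Y) :
    IsHeatSolution 0 univ S (fun t => φ t + halfLineSolution φ t 2) (stripSolution φ) := by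
  obtain ⟨Gy, Gyy, hGy, hGyy, hG⟩ := hY
  have hc := hφ.continuous_halfLineSolution hδ
  have hm₁ : ∀ g : ℝ → ℝ → ℝ, ContinuousOn (fun p : ℝ × ℝ => g p.1 p.2) (univ ×ˢ Y) →
      ContinuousOn (fun p : ℝ × ℝ => g p.1 (1 - p.2)) (univ ×ˢ S) := fun g hg =>
    hg.comp (f := fun p : ℝ × ℝ => (p.1, 1 - p.2)) (by fun_prop) fun p hp => ⟨hp.1, hS₁ _ hp.2⟩
  have hm₂ : ∀ g : ℝ → ℝ → ℝ, ContinuousOn (fun p : ℝ × ℝ => g p.1 p.2) (univ ×ˢ Y) →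
      ContinuousOn (fun p : ℝ × ℝ => g p.1 (1 + p.2)) (univ ×ˢ S) := fun g hg =>
    hg.comp (f := fun p : ℝ × ℝ => (p.1, 1 + p.2)) (by fun_prop) fun p hp => ⟨hp.1, hS₂ _ hp.2⟩
  have hd₁ : ∀ (g : ℝ → ℝ) (g' l : ℝ), HasDerivWithinAt g g' Y (1 - l) → l ∈ S →
      HasDerivWithinAt (fun r => g (1 - r)) (-g') S l := fun g g' l hg _ => by
    have := hg.comp l ((hasDerivWithinAt_id l S).const_sub 1) hS₁
    simpa [Function.comp_def] using this
  have hd₂ : ∀ (g : ℝ → ℝ) (g' l : ℝ), HasDerivWithinAt g g' Y (1 + l) → l ∈ S →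
      HasDerivWithinAt (fun r => g (1 + r)) g' S l := fun g g' l hg _ => by
    have := hg.comp l ((hasDerivWithinAt_id l S).const_add 1) hS₂
    simpa [Function.comp_def] using this
  refine ⟨?_, ⟨fun t l => Gyy t (1 - l) + Gyy t (1 + l), fun t l => -Gy t (1 - l) + Gy t (1 + l),
    fun t l => Gyy t (1 - l) + Gyy t (1 + l), (hm₁ _ hGyy).add (hm₂ _ hGyy),
    (hm₁ _ hGy).neg.add (hm₂ _ hGy), (hm₁ _ hGyy).add (hm₂ _ hGyy), fun t _ l hl => ?_,
    fun t _ => by simp⟩, fun t _ => ?_⟩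
  · exact ((hc.comp (by fun_prop : Continuous fun p : ℝ × ℝ => (p.1, 1 - p.2))).add
      (hc.comp (by fun_prop : Continuous fun p : ℝ × ℝ => (p.1, 1 + p.2)))).continuousOn
  · obtain ⟨ht₁, hy₁, hyy₁⟩ := hG t _ (hS₁ l hl)
    obtain ⟨ht₂, hy₂, hyy₂⟩ := hG t _ (hS₂ l hl)
    refine ⟨(ht₁.add ht₂).hasDerivWithinAt, (hd₁ _ _ l hy₁ hl).add (hd₂ _ _ l hy₂ hl), ?_,
      by ring⟩
    have := (hd₁ _ _ l hyy₁ hl).fun_neg.add (hd₂ _ _ l hyy₂ hl)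
    rwa [neg_neg] at this
  · norm_num [stripSolution, halfLineSolution_zero]

theorem exists_heatSolution (hδ : 0 < δ) (hU : HasExpDecay δ U) :
    ∃ v : ℝ → ℝ → ℝ, IsHeatSolution 0 univ (Ico 0 1) U v ∧
      (ContDiff ℝ 1 U → IsHeatSolution 0 univ (Icc 0 1) U v) ∧
      ∀ T : ℝ, ∃ K : ℝ, ∀ t ≤ T, ∀ l ∈ Icc (0 : ℝ) 1, |v t l| ≤ K := by
  obtain ⟨φ, hφ, hφU⟩ := exists_add_halfLineSolution_eq hδ hU
  have hfun : U = fun t => φ t + halfLineSolution φ t 2 := funext fun t => (hφU t).symm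
  refine ⟨stripSolution φ, ?_, fun hU1 => ?_, fun T => ?_⟩
  · rw [hfun]
    exact isHeatSolution_stripSolution hδ hφ (hφ.isHeatRegularOn_Ioi hδ)
      (fun l hl => sub_pos.2 hl.2) fun l hl => by simp only [mem_Ioi]; linarith [hl.1]
  -- In `φ = U - Gφ(·,2)` the last term is evaluated away from the boundary, so it is `C¹` in time
  -- and `φ` inherits the regularity of `U`.
  · set φ' : ℝ → ℝ := fun t => deriv U t - kernelIntegral boundaryKernelDyy φ t 2 with hφ'
    have hder : ∀ t, HasDerivAt φ (φ' t) t := fun t => by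
      have := ((hU1.differentiable one_ne_zero t).hasDerivAt).sub
        (hasDerivAt_halfLineSolution_time hδ hφ t two_pos)
      refine this.congr_of_eventuallyEq (Eventually.of_forall fun s => ?_)
      simp [← hφU s]
    have hc : Continuous φ' := by
      refine (hU1.continuous_deriv le_rfl).sub ?_
      exact (continuousOn_kernelIntegral hδ isHalfLineKernel_boundaryKernelDyy hφ).comp_continuous
        (f := fun t : ℝ => (t, (2 : ℝ))) (by fun_prop) fun t => ⟨trivial, mem_Ioi.2 two_pos⟩
    rw [hfun]
    exact isHeatSolution_stripSolution hδ hφ (hφ.isHeatRegularOn_Ici hδ hder hc)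
      (fun l hl => sub_nonneg.2 hl.2) fun l hl => by simp only [mem_Ici]; linarith [hl.1]
  · obtain ⟨K, hK⟩ := hφ.bounded hδ T
    -- The half line solution averages past values of `φ` against a probability density, so it keeps
    -- the bound `K`.
    have hG : ∀ t ≤ T, ∀ y, |halfLineSolution φ t y| ≤ K := fun t ht y => by
      have h := norm_integral_le_of_norm_le (μ := volume.restrict (Ioi 0))
        (f := fun σ => φ (t - (y / (2 * σ)) ^ 2) * Real.exp (-σ ^ 2))
        (integrable_exp_neg_sq.integrableOn.const_mul K) (ae_of_all _ fun σ => ?_)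
      · rw [integral_const_mul, integral_Ioi_exp_neg_sq] at h
        have hpi : 0 < Real.sqrt Real.pi := Real.sqrt_pos.2 Real.pi_pos
        rw [halfLineSolution, abs_mul, abs_of_pos (by positivity)]
        calc _ ≤ 2 / Real.sqrt Real.pi * (K * (Real.sqrt Real.pi / 2)) :=
              mul_le_mul_of_nonneg_left h (by positivity)
          _ = K := by field_simp
      · rw [norm_mul, Real.norm_of_nonneg (Real.exp_pos _).le]
        gcongr
        exact hK _ (by nlinarith [sq_nonneg (y / (2 * σ))])
    exact ⟨K + K, fun t ht l _ => (abs_add_le _ _).trans (add_le_add (hG t ht _) (hG t ht _))⟩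

end
-- Completeness of the cosines, and the equation for Fourier modes.
section
open MeasureTheory Filter Topology

/-- Multiplication by `cos (π l)` averages the modes `k + 1` and `k - 1`; indexing by `ℤ` keeps the
family closed under both shifts. -/
theorem integral_mul_cos_mul_cos_pow {F : ℝ → ℝ} (hF : ContinuousOn F (Icc 0 1))
    (h : ∀ k : ℤ, ∫ l in (0 : ℝ)..1, F l * Real.cos ((k + 1 / 2) * Real.pi * l) = 0) (j : ℕ) :
    ∀ k : ℤ, ∫ l in (0 : ℝ)..1,
      F l * Real.cos ((k + 1 / 2) * Real.pi * l) * Real.cos (Real.pi * l) ^ j = 0 := by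
  have hint : ∀ (j : ℕ) (k : ℤ), IntervalIntegrable (fun l =>
      F l * Real.cos ((k + 1 / 2) * Real.pi * l) * Real.cos (Real.pi * l) ^ j) volume 0 1 := by
    intro j k
    refine ContinuousOn.intervalIntegrable ?_
    rw [uIcc_of_le zero_le_one]
    exact (hF.mul (by fun_prop)).mul (by fun_prop)
  induction j with
  | zero => simpa using h
  | succ j ih =>
    intro k
    have e : ∀ l : ℝ,
        F l * Real.cos ((k + 1 / 2) * Real.pi * l) * Real.cos (Real.pi * l) ^ (j + 1) =
        1 / 2 * (F l * Real.cos (((k + 1 : ℤ) + 1 / 2) * Real.pi * l) *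
            Real.cos (Real.pi * l) ^ j +
          F l * Real.cos (((k - 1 : ℤ) + 1 / 2) * Real.pi * l) *
            Real.cos (Real.pi * l) ^ j) := by
      intro l
      have h1 : (((k + 1 : ℤ) : ℝ) + 1 / 2) * Real.pi * l =
          (k + 1 / 2) * Real.pi * l + Real.pi * l := by
        push_cast
        ring
      have h2 : (((k - 1 : ℤ) : ℝ) + 1 / 2) * Real.pi * l =
          (k + 1 / 2) * Real.pi * l - Real.pi * l := by
        push_cast
        ring
      rw [h1, h2, Real.cos_add, Real.cos_sub]
      ring
    simp_rw [e]
    rw [intervalIntegral.integral_const_mul,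
      intervalIntegral.integral_add (hint j (k + 1)) (hint j (k - 1)), ih, ih]
    norm_num

/-- The functions `cos ((k + 1/2) π l)` are complete on `[0,1]`. -/
theorem eq_zero_of_integral_mul_cos {F : ℝ → ℝ} (hF : ContinuousOn F (Icc 0 1))
    (h : ∀ k : ℤ, ∫ l in (0 : ℝ)..1, F l * Real.cos ((k + 1 / 2) * Real.pi * l) = 0) :
    ∀ l ∈ Icc (0 : ℝ) 1, F l = 0 := by
  have hpi := Real.pi_pos
  -- Through `z = cos (π l)`, `W` is a continuous function of `z ∈ [-1,1]`, orthogonal to all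
  -- polynomials in `z`. Weierstrass approximation of `W` itself gives `∫ W² = 0`. The factor `cos
  -- (π l / 2)` is positive on `[0,1)`, and the point `1` follows by continuity.
  set W : ℝ → ℝ := fun l => F l * Real.cos (Real.pi * l / 2) with hW
  have hWc : ContinuousOn W (Icc 0 1) := hF.mul (by fun_prop)
  have hpow : ∀ j : ℕ, ∫ l in (0 : ℝ)..1, W l * Real.cos (Real.pi * l) ^ j = 0 := fun j => by
    have := integral_mul_cos_mul_cos_pow hF h j 0
    simp only [Int.cast_zero, zero_add] at this
    rw [← this]
    congr 1 with l
    rw [hW, show 1 / 2 * Real.pi * l = Real.pi * l / 2 by ring]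
  have hint : ∀ p : Polynomial ℝ, IntervalIntegrable
      (fun l => W l * p.eval (Real.cos (Real.pi * l))) volume 0 1 := by
    intro p
    refine ContinuousOn.intervalIntegrable ?_
    rw [uIcc_of_le zero_le_one]
    exact hWc.mul (p.continuous.comp (by fun_prop)).continuousOn
  have hpoly : ∀ p : Polynomial ℝ,
      ∫ l in (0 : ℝ)..1, W l * p.eval (Real.cos (Real.pi * l)) = 0 := by
    intro p
    induction p using Polynomial.induction_on' with
    | add p q hp hq =>
      simp only [Polynomial.eval_add, mul_add]
      rw [intervalIntegral.integral_add (hint p) (hint q), hp, hq, add_zero]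
    | monomial n a =>
      simp only [Polynomial.eval_monomial]
      simp_rw [mul_left_comm _ a]
      rw [intervalIntegral.integral_const_mul, hpow, mul_zero]
  obtain ⟨M, hM⟩ := isCompact_Icc.exists_bound_of_continuousOn hWc
  have hM0 : 0 ≤ M := (norm_nonneg _).trans (hM 0 ⟨le_rfl, zero_le_one⟩)
  have hqc : ContinuousOn (fun z => W (Real.arccos z / Real.pi)) (Icc (-1) 1) := by
    refine hWc.comp (Real.continuous_arccos.div_const _).continuousOn fun z _ => ⟨?_, ?_⟩
    · exact div_nonneg (Real.arccos_nonneg z) hpi.le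
    · exact div_le_one_of_le₀ (Real.arccos_le_pi z) hpi.le
  have hsq : ∫ l in (0 : ℝ)..1, W l ^ 2 ≤ 0 := by
    refine le_of_forall_pos_le_add fun ε hε => ?_
    obtain ⟨p, hp⟩ := exists_polynomial_near_of_continuousOn (-1) 1 _ hqc (ε / (M + 1))
      (by positivity)
    have hWi : IntervalIntegrable (fun l => W l ^ 2) volume 0 1 := by
      refine ContinuousOn.intervalIntegrable ?_
      rw [uIcc_of_le zero_le_one]
      exact hWc.pow 2
    have e : ∫ l in (0 : ℝ)..1, W l ^ 2 =
        ∫ l in (0 : ℝ)..1, (W l ^ 2 - W l * p.eval (Real.cos (Real.pi * l))) := by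
      rw [intervalIntegral.integral_sub hWi (hint p), hpoly, sub_zero]
    have hb : ∀ l ∈ uIoc (0 : ℝ) 1, ‖W l ^ 2 - W l * p.eval (Real.cos (Real.pi * l))‖ ≤ ε := by
      intro l hl
      rw [uIoc_of_le zero_le_one] at hl
      have h1 := hp (Real.cos (Real.pi * l)) (Real.cos_mem_Icc _)
      rw [Real.arccos_cos (by nlinarith [hl.1]) (by nlinarith [hl.2]),
        mul_div_cancel_left₀ _ hpi.ne', abs_sub_comm] at h1
      have h2 := hM l ⟨hl.1.le, hl.2⟩
      rw [show W l ^ 2 - W l * p.eval (Real.cos (Real.pi * l)) =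
        W l * (W l - p.eval (Real.cos (Real.pi * l))) by ring, norm_mul]
      calc ‖W l‖ * ‖W l - p.eval (Real.cos (Real.pi * l))‖ ≤ M * (ε / (M + 1)) :=
            mul_le_mul h2 h1.le (norm_nonneg _) hM0
        _ ≤ (M + 1) * (ε / (M + 1)) := by gcongr; linarith
        _ = ε := by field_simp
    have := intervalIntegral.norm_integral_le_of_norm_le_const hb
    rw [e]
    calc _ ≤ _ := le_abs_self _
      _ ≤ _ := this
      _ = _ := by norm_num
  have hW0 : ∀ l ∈ Icc (0 : ℝ) 1, W l = 0 := by
    by_contra! hne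
    obtain ⟨l, hl, hne⟩ := hne
    have := intervalIntegral.integral_pos (f := fun l => W l ^ 2) zero_lt_one (hWc.pow 2)
      (fun _ _ => sq_nonneg _) ⟨l, hl, by positivity⟩
    linarith
  have hF0 : EqOn F (fun _ => 0) (Ico 0 1) := fun l hl => by
    have hc : 0 < Real.cos (Real.pi * l / 2) :=
      Real.cos_pos_of_mem_Ioo ⟨by nlinarith [hl.1], by nlinarith [hl.2]⟩
    exact (mul_eq_zero.1 (hW0 l ⟨hl.1, hl.2.le⟩)).resolve_right hc.ne'
  exact hF0.of_subset_closure hF continuousOn_const Ico_subset_Icc_self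
    (by rw [closure_Ico zero_ne_one])

/-- The Fourier mode `k` of `s ↦ d (t, b s)`. -/
noncomputable def scaledMode (d : ℝ → ℝ → ℝ) (μ b t : ℝ) : ℝ :=
  ∫ s in (0 : ℝ)..1, d t (b * s) * Real.cos (μ * s)

/-- The derivatives of `d` may blow up at `l = 1`, so the integration by parts takes place on
`[0,b]` with `b < 1`. Rescaling the cosine to this interval puts its zero at `l = b`. This kills the
uncontrolled flux there and leaves only the boundary value `d t b`. -/
theorem hasDerivAt_scaledMode {d : ℝ → ℝ → ℝ}
    (hd : IsHeatSolution 0 (Iic 0) (Ico 0 1) (fun _ => 0) d) {μ b t : ℝ} (hμ : Real.cos μ = 0)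
    (hb : b ∈ Ioo (0 : ℝ) 1) (ht : t < 0) :
    HasDerivAt (scaledMode d μ b)
      (μ / b ^ 2 * (d t b * Real.sin μ - μ * scaledMode d μ b t)) t := by
  obtain ⟨wt, wl, wll, hwt, hwl, hwll, hder, hneu⟩ := hd.heat_neumann
  have hb0 := hb.1
  have hS : ∀ s ∈ Icc (0 : ℝ) 1, b * s ∈ Ico (0 : ℝ) 1 := fun s hs =>
    ⟨mul_nonneg hb0.le hs.1, lt_of_le_of_lt (mul_le_of_le_one_right hb0.le hs.2) hb.2⟩
  have hslice : ∀ g : ℝ → ℝ → ℝ, ContinuousOn (fun p : ℝ × ℝ => g p.1 p.2) (Iic 0 ×ˢ Ico 0 1) →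
      ∀ r ≤ 0, ContinuousOn (fun s => g r (b * s)) (Icc 0 1) := fun g hg r hr =>
    hg.comp (f := fun s : ℝ => (r, b * s)) (by fun_prop) fun s hs => ⟨hr, hS s hs⟩
  have hdc : ContinuousOn (fun p : ℝ × ℝ => d p.1 p.2) (Iic 0 ×ˢ Ico 0 1) :=
    hd.continuousOn.mono (prod_mono Subset.rfl Ico_subset_Icc_self)
  have hcos : ContinuousOn (fun s : ℝ => Real.cos (μ * s)) (Icc 0 1) := by fun_prop
  have hsin : ContinuousOn (fun s : ℝ => Real.sin (μ * s)) (Icc 0 1) := by fun_prop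
  have hii : ∀ f : ℝ → ℝ, ContinuousOn f (Icc 0 1) → IntervalIntegrable f volume 0 1 :=
    fun f hf => ContinuousOn.intervalIntegrable (by rwa [uIcc_of_le zero_le_one])
  have hmeas : ∀ f : ℝ → ℝ, ContinuousOn f (Icc 0 1) →
      AEStronglyMeasurable f (volume.restrict (uIoc (0 : ℝ) 1)) := fun f hf => by
    rw [uIoc_of_le zero_le_one]
    exact (hf.mono Ioc_subset_Icc_self).aestronglyMeasurable measurableSet_Ioc
  obtain ⟨M, hM⟩ := (isCompact_Icc.prod isCompact_Icc).exists_bound_of_continuousOn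
    (s := Icc (t - 1) (t / 2) ×ˢ Icc 0 b)
    (hwt.mono (prod_mono (fun r hr => by simp only [mem_Iic]; linarith [hr.2])
      fun l hl => ⟨hl.1, lt_of_le_of_lt hl.2 hb.2⟩))
  have hmain := (intervalIntegral.hasDerivAt_integral_of_dominated_loc_of_deriv_le
    (μ := volume) (a := 0) (b := 1) (F := fun r s => d r (b * s) * Real.cos (μ * s))
    (F' := fun r s => wt r (b * s) * Real.cos (μ * s)) (bound := fun _ => M)
    (s := Icc (t - 1) (t / 2)) (x₀ := t) (Icc_mem_nhds (by linarith) (by linarith)) ?_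
    (hii _ ((hslice d hdc t ht.le).mul hcos)) (hmeas _ ((hslice wt hwt t ht.le).mul hcos)) ?_
    intervalIntegrable_const ?_).2
  · refine hmain.congr_deriv ?_
    have hpde : ∫ s in (0 : ℝ)..1, wt t (b * s) * Real.cos (μ * s) =
        ∫ s in (0 : ℝ)..1, wll t (b * s) * Real.cos (μ * s) := by
      refine intervalIntegral.integral_congr fun s hs => ?_
      rw [uIcc_of_le zero_le_one] at hs
      simp only [(hder t ht.le _ (hS s hs)).2.2.2, zero_mul, sub_zero]
    have hchain : ∀ g : ℝ → ℝ, ∀ g' : ℝ → ℝ,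
        (∀ l ∈ Ico (0 : ℝ) 1, HasDerivWithinAt g (g' l) (Ico 0 1) l) →
        ∀ s ∈ Ioo (min (0 : ℝ) 1) (max 0 1),
          HasDerivAt (fun s => g (b * s)) (b * g' (b * s)) s := by
      intro g g' hg s hs
      rw [min_eq_left zero_le_one, max_eq_right zero_le_one] at hs
      have hm := hS s ⟨hs.1.le, hs.2.le⟩
      have h1 : HasDerivAt g (g' (b * s)) (b * s) :=
        (hg _ hm).hasDerivAt (Ico_mem_nhds (mul_pos hb0 hs.1) hm.2)
      have h2 := h1.comp s ((hasDerivAt_id s).const_mul b)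
      simpa [Function.comp_def, mul_comm] using h2
    have hcosd : ∀ s ∈ Ioo (min (0 : ℝ) 1) (max 0 1),
        HasDerivAt (fun s => Real.cos (μ * s)) (-(μ * Real.sin (μ * s))) s := fun s _ => by
      have := ((hasDerivAt_id s).const_mul μ).cos
      simpa [mul_comm] using this
    have hsind : ∀ s ∈ Ioo (min (0 : ℝ) 1) (max 0 1),
        HasDerivAt (fun s => Real.sin (μ * s)) (μ * Real.cos (μ * s)) s := fun s _ => by
      have := ((hasDerivAt_id s).const_mul μ).sin
      simpa [mul_comm] using this
    have hu : ∀ f : ℝ → ℝ, ContinuousOn f (Icc 0 1) → ContinuousOn f (uIcc 0 1) := fun f hf => by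
      rwa [uIcc_of_le zero_le_one]
    have ibp1 := intervalIntegral.integral_mul_deriv_eq_deriv_mul_of_hasDerivAt
      (hu _ hcos) (hu _ (hslice wl hwl t ht.le)) hcosd
      (hchain (wl t) (wll t) fun l hl => (hder t ht.le l hl).2.2.1)
      (hii _ (by fun_prop)) (hii _ ((hslice wll hwll t ht.le).const_smul b))
    have ibp2 := intervalIntegral.integral_mul_deriv_eq_deriv_mul_of_hasDerivAt
      (hu _ hsin) (hu _ (hslice d hdc t ht.le)) hsind
      (hchain (d t) (wl t) fun l hl => (hder t ht.le l hl).2.1)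
      (hii _ (by fun_prop)) (hii _ ((hslice wl hwl t ht.le).const_smul b))
    simp only [mul_one, mul_zero, hμ, hneu t ht.le, Real.sin_zero, zero_mul, sub_zero,
      zero_sub, neg_mul, intervalIntegral.integral_neg, neg_neg] at ibp1 ibp2
    have e1 : ∫ s in (0 : ℝ)..1, Real.cos (μ * s) * (b * wll t (b * s)) =
        b * ∫ s in (0 : ℝ)..1, wll t (b * s) * Real.cos (μ * s) := by
      rw [← intervalIntegral.integral_const_mul]
      congr 1 with s
      ring
    have e2 : ∫ s in (0 : ℝ)..1, Real.sin (μ * s) * (b * wl t (b * s)) =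
        b * ∫ s in (0 : ℝ)..1, Real.sin (μ * s) * wl t (b * s) := by
      rw [← intervalIntegral.integral_const_mul]
      congr 1 with s
      ring
    have e3 : ∫ s in (0 : ℝ)..1, μ * Real.sin (μ * s) * wl t (b * s) =
        μ * ∫ s in (0 : ℝ)..1, Real.sin (μ * s) * wl t (b * s) := by
      rw [← intervalIntegral.integral_const_mul]
      congr 1 with s
      ring
    have e4 : ∫ s in (0 : ℝ)..1, μ * Real.cos (μ * s) * d t (b * s) =
        μ * scaledMode d μ b t := by
      rw [scaledMode, ← intervalIntegral.integral_const_mul]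
      congr 1 with s
      ring
    rw [e1, e3] at ibp1
    rw [e2, e4] at ibp2
    rw [hpde]
    rw [div_mul_eq_mul_div, eq_div_iff (by positivity)]
    linear_combination b * ibp1 + μ * ibp2
  · filter_upwards [Iio_mem_nhds ht] with r hr
    exact hmeas _ ((hslice d hdc r (le_of_lt hr)).mul hcos)
  · refine ae_of_all _ fun s hs r hr => ?_
    rw [uIoc_of_le zero_le_one] at hs
    have h1 := hM (r, b * s) ⟨hr, mul_nonneg hb0.le hs.1.le, mul_le_of_le_one_right hb0.le hs.2⟩
    rw [norm_mul]
    calc _ ≤ ‖wt r (b * s)‖ * 1 := by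
          gcongr
          exact Real.abs_cos_le_one _
      _ ≤ M := by rwa [mul_one]
  · refine ae_of_all _ fun s hs r hr => HasDerivAt.mul_const ?_ _
    rw [uIoc_of_le zero_le_one] at hs
    have hr0 : r < 0 := by linarith [hr.2]
    exact (hder r hr0.le _ (hS s ⟨hs.1.le, hs.2⟩)).1.hasDerivAt (Iic_mem_nhds hr0)

end
-- Uniqueness on `(-∞,0]`, and operations on solutions.
section
open MeasureTheory Filter Topology

/-- The mode equation on `[0,b]`, integrated in time, involves only continuous quantities and passes
to the limit `b → 1`, where the boundary term vanishes. So `exp (μ² t)` times the mode is constant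
in time, and the `L²` bound forces it to tend to `0` at `-∞`. -/
theorem integral_mul_cos_eq_zero {d : ℝ → ℝ → ℝ}
    (hd : IsHeatSolution 0 (Iic 0) (Ico 0 1) (fun _ => 0) d)
    {M : ℝ} (hM : ∀ t ≤ 0, ∫ l in (0 : ℝ)..1, d t l ^ 2 ≤ M) {μ : ℝ} (hμ : Real.cos μ = 0)
    {t : ℝ} (ht : t < 0) : ∫ l in (0 : ℝ)..1, d t l * Real.cos (μ * l) = 0 := by
  have hμ0 : μ ≠ 0 := fun h => by simp [h] at hμ
  -- `ρ` is `1/b` for `b ≥ 1/2`, and `D` is `d` with clamped arguments: globally continuous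
  -- replacements.
  set ρ : ℝ → ℝ := fun b => (max b (1 / 2))⁻¹ with hρ
  have hρc : Continuous ρ := (continuous_id.max continuous_const).inv₀ fun b =>
    (lt_of_lt_of_le (by norm_num) (le_max_right b (1 / 2))).ne'
  set D : ℝ × ℝ → ℝ := fun p => d (min p.1 0) (max 0 (min p.2 1)) with hD
  have hDc : Continuous D := hd.continuousOn.comp_continuous
    (f := fun p : ℝ × ℝ => (min p.1 0, max 0 (min p.2 1))) (by fun_prop) fun p => by simp
  have hDd : ∀ r ≤ 0, ∀ l ∈ Icc (0 : ℝ) 1, D (r, l) = d r l := fun r hr l hl => by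
    simp [hD, min_eq_left hr, min_eq_left hl.2, max_eq_right hl.1]
  set E : ℝ → ℝ → ℝ := fun b r => Real.exp ((μ * ρ b) ^ 2 * r) *
    ∫ s in (0 : ℝ)..1, D (r, b * s) * Real.cos (μ * s) with hE
  have hEc : ∀ r, Continuous fun b => E b r := fun r => by
    refine Continuous.mul (by fun_prop) ?_
    exact intervalIntegral.continuous_parametric_intervalIntegral_of_continuous'
      (f := fun b s => D (r, b * s) * Real.cos (μ * s)) (by
        simp only [Function.uncurry_def]
        fun_prop) 0 1
  have hid : ∀ b ∈ Ico (1 / 2 : ℝ) 1, ∀ r < t, E b t - E b r =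
      ∫ s in r..t, Real.exp ((μ * ρ b) ^ 2 * s) * (μ * ρ b ^ 2 * Real.sin μ * D (s, b)) := by
    intro b hb r hr
    have hb0 : 0 < b := by linarith [hb.1]
    have hρb : ρ b = b⁻¹ := by simp only [hρ, max_eq_left hb.1]
    symm
    refine intervalIntegral.integral_eq_sub_of_hasDerivAt (fun s hs => ?_)
      (Continuous.intervalIntegrable (by fun_prop) _ _)
    rw [uIcc_of_le hr.le] at hs
    have hs0 : s < 0 := lt_of_le_of_lt hs.2 ht
    have hmode := hasDerivAt_scaledMode hd hμ ⟨hb0, hb.2⟩ hs0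
    have hexp : HasDerivAt (fun s => Real.exp ((μ * ρ b) ^ 2 * s))
        (Real.exp ((μ * ρ b) ^ 2 * s) * (μ * ρ b) ^ 2) s := by
      simpa using ((hasDerivAt_id s).const_mul ((μ * ρ b) ^ 2)).exp
    refine ((hexp.mul hmode).congr_deriv ?_).congr_of_eventuallyEq ?_
    · rw [hDd s hs0.le b ⟨hb0.le, hb.2.le⟩, hρb]
      field_simp
      ring
    · filter_upwards [Iio_mem_nhds hs0] with q hq
      simp only [hE, scaledMode, Pi.mul_apply]
      congr 1
      refine intervalIntegral.integral_congr fun l hl => ?_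
      rw [uIcc_of_le zero_le_one] at hl
      rw [hDd q (le_of_lt hq) (b * l) ⟨mul_nonneg hb0.le hl.1,
        mul_le_one₀ hb.2.le hl.1 hl.2⟩]
  have hconst : ∀ r < t, E 1 t = E 1 r := by
    intro r hr
    have hR : Continuous fun b => ∫ s in r..t, Real.exp ((μ * ρ b) ^ 2 * s) *
        (μ * ρ b ^ 2 * Real.sin μ * D (s, b)) :=
      intervalIntegral.continuous_parametric_intervalIntegral_of_continuous'
        (f := fun b s => Real.exp ((μ * ρ b) ^ 2 * s) *
          (μ * ρ b ^ 2 * Real.sin μ * D (s, b))) (by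
        simp only [Function.uncurry_def]
        fun_prop) r t
    have hcl : (1 : ℝ) ∈ closure (Ico (1 / 2 : ℝ) 1) := by
      rw [closure_Ico (by norm_num)]
      constructor <;> norm_num
    have := Set.EqOn.closure (s := Ico (1 / 2 : ℝ) 1) (fun b hb => hid b hb r hr)
      ((hEc t).sub (hEc r)) hR hcl
    simp only at this
    rw [intervalIntegral.integral_congr (g := fun _ => 0), intervalIntegral.integral_zero,
      sub_eq_zero] at this
    · exact this
    · intro s hs
      rw [uIcc_of_le hr.le] at hs
      have hs0 : s ≤ 0 := hs.2.trans ht.le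
      simp only
      rw [hDd s hs0 1 ⟨zero_le_one, le_rfl⟩, hd.dirichlet s hs0, mul_zero, mul_zero]
  have hE1 : ∀ r ≤ 0, E 1 r =
      Real.exp (μ ^ 2 * r) * ∫ s in (0 : ℝ)..1, d r s * Real.cos (μ * s) := by
    intro r hr
    have : ρ 1 = 1 := by norm_num [hρ]
    simp only [hE, this, mul_one, one_mul]
    congr 1
    refine intervalIntegral.integral_congr fun l hl => ?_
    rw [uIcc_of_le zero_le_one] at hl
    simp only [hDd r hr l hl]
  have hbound : ∀ r ≤ 0, |∫ s in (0 : ℝ)..1, d r s * Real.cos (μ * s)| ≤ (1 + M) / 2 := by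
    intro r hr
    have hdr : ContinuousOn (d r) (uIcc 0 1) := by
      rw [uIcc_of_le zero_le_one]
      exact hd.continuousOn.comp (f := fun s : ℝ => (r, s)) (by fun_prop) fun s hs => ⟨hr, hs⟩
    have hint : IntervalIntegrable (fun s => d r s ^ 2) volume 0 1 :=
      (hdr.pow 2).intervalIntegrable
    have h := intervalIntegral.norm_integral_le_of_norm_le (μ := volume) zero_le_one
      (f := fun s => d r s * Real.cos (μ * s)) (g := fun s => (1 + d r s ^ 2) / 2)
      (ae_of_all _ fun s _ => ?_) ((intervalIntegrable_const.add hint).div_const 2)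
    · refine h.trans ?_
      rw [intervalIntegral.integral_div, intervalIntegral.integral_add intervalIntegrable_const
        hint]
      have := hM r hr
      simp only [intervalIntegral.integral_const, sub_zero, smul_eq_mul, mul_one]
      linarith
    · rw [norm_mul, Real.norm_eq_abs, Real.norm_eq_abs]
      have h1 := Real.abs_cos_le_one (μ * s)
      have h2 := sq_abs (d r s)
      nlinarith [abs_nonneg (d r s), sq_nonneg (|d r s| - 1)]
  have hle : |E 1 t| ≤ 0 := by
    have hlim : Tendsto (fun r => Real.exp (μ ^ 2 * r) * ((1 + M) / 2)) atBot
        (𝓝 (0 * ((1 + M) / 2))) := by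
      refine (Real.tendsto_exp_atBot.comp ?_).mul_const _
      exact tendsto_id.const_mul_atBot (by positivity)
    rw [zero_mul] at hlim
    refine ge_of_tendsto hlim ?_
    filter_upwards [eventually_lt_atBot t] with r hr
    rw [hconst r hr, hE1 r (hr.le.trans ht.le), abs_mul, abs_of_pos (Real.exp_pos _)]
    exact mul_le_mul_of_nonneg_left (hbound r (hr.le.trans ht.le)) (Real.exp_pos _).le
  have h0 := abs_eq_zero.1 (le_antisymm hle (abs_nonneg _))
  rw [hE1 t ht.le] at h0
  exact (mul_eq_zero.1 h0).resolve_left (Real.exp_pos _).ne'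

theorem eq_zero_of_isHeatSolution {d : ℝ → ℝ → ℝ}
    (hd : IsHeatSolution 0 (Iic 0) (Ico 0 1) (fun _ => 0) d)
    {M : ℝ} (hM : ∀ t ≤ 0, ∫ l in (0 : ℝ)..1, d t l ^ 2 ≤ M) :
    ∀ t ≤ 0, ∀ l ∈ Icc (0 : ℝ) 1, d t l = 0 := by
  have hneg : ∀ t < 0, ∀ l ∈ Icc (0 : ℝ) 1, d t l = 0 := fun t ht =>
    eq_zero_of_integral_mul_cos
      (hd.continuousOn.comp (f := fun s : ℝ => (t, s)) (by fun_prop)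
        fun s hs => ⟨le_of_lt ht, hs⟩)
      fun k => integral_mul_cos_eq_zero hd hM
        (Real.cos_eq_zero_iff.2 ⟨k, by ring⟩) ht
  -- The modes were handled for `t < 0`, where time derivatives are two-sided; `t = 0` follows by
  -- continuity.
  intro t ht l hl
  have hE : EqOn (fun t => d t l) (fun _ => 0) (Iio 0) := fun t ht => hneg t ht l hl
  exact hE.of_subset_closure (t := Iic 0)
    (hd.continuousOn.comp (f := fun s : ℝ => (s, l)) (by fun_prop) fun s hs => ⟨hs, hl⟩)
    continuousOn_const Iio_subset_Iic_self (by rw [closure_Iio]) ht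

variable {γ : ℝ} {J J' S : Set ℝ} {u u' : ℝ → ℝ} {w w' : ℝ → ℝ → ℝ}

theorem IsHeatSolution.exp_mul (hw : IsHeatSolution γ J S u w) (hS : S ⊆ Icc 0 1) (β : ℝ) :
    IsHeatSolution (γ + β) J S (fun t => Real.exp (-β * t) * u t)
      (fun t l => Real.exp (-β * t) * w t l) := by
  obtain ⟨wt, wl, wll, hwt, hwl, hwll, hder, hneu⟩ := hw.heat_neumann
  have hexp : ∀ A : Set (ℝ × ℝ), ContinuousOn (fun p : ℝ × ℝ => Real.exp (-β * p.1)) A :=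
    fun A => by fun_prop
  refine ⟨(hexp _).mul hw.continuousOn, ⟨fun t l => Real.exp (-β * t) * (wt t l - β * w t l),
    fun t l => Real.exp (-β * t) * wl t l, fun t l => Real.exp (-β * t) * wll t l,
    (hexp _).mul (hwt.sub (continuousOn_const.mul ?_)), (hexp _).mul hwl, (hexp _).mul hwll,
    fun t ht l hl => ?_, fun t ht => by simp only [hneu t ht, mul_zero]⟩,
    fun t ht => by simp only [hw.dirichlet t ht]⟩
  · exact hw.continuousOn.mono (prod_mono Subset.rfl hS)
  · obtain ⟨h1, h2, h3, h4⟩ := hder t ht l hl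
    have he : HasDerivAt (fun s => Real.exp (-β * s)) (Real.exp (-β * t) * -β) t := by
      simpa using ((hasDerivAt_id t).const_mul (-β)).exp
    refine ⟨(he.hasDerivWithinAt.mul h1).congr_deriv (by ring), h2.const_mul _, h3.const_mul _, ?_⟩
    simp only [h4]
    ring

theorem IsHeatSolution.sub (hw : IsHeatSolution γ J S u w) (hw' : IsHeatSolution γ J S u' w') :
    IsHeatSolution γ J S (fun t => u t - u' t) (fun t l => w t l - w' t l) := by
  obtain ⟨wt, wl, wll, hwt, hwl, hwll, hder, hneu⟩ := hw.heat_neumann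
  obtain ⟨wt', wl', wll', hwt', hwl', hwll', hder', hneu'⟩ := hw'.heat_neumann
  refine ⟨hw.continuousOn.sub hw'.continuousOn, ⟨fun t l => wt t l - wt' t l,
    fun t l => wl t l - wl' t l, fun t l => wll t l - wll' t l, hwt.sub hwt', hwl.sub hwl',
    hwll.sub hwll', fun t ht l hl => ?_, fun t ht => by simp only [hneu t ht, hneu' t ht, sub_self]⟩,
    fun t ht => by simp only [hw.dirichlet t ht, hw'.dirichlet t ht]⟩
  obtain ⟨h1, h2, h3, h4⟩ := hder t ht l hl
  obtain ⟨h1', h2', h3', h4'⟩ := hder' t ht l hl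
  refine ⟨h1.sub h1', h2.sub h2', h3.sub h3', ?_⟩
  simp only [h4, h4']
  ring

theorem IsHeatSolution.mono (hw : IsHeatSolution γ J S u w) (hJ : J' ⊆ J) :
    IsHeatSolution γ J' S u w := by
  obtain ⟨wt, wl, wll, hwt, hwl, hwll, hder, hneu⟩ := hw.heat_neumann
  have hp : ∀ A : Set ℝ, J' ×ˢ A ⊆ J ×ˢ A := fun A => prod_mono hJ Subset.rfl
  refine ⟨hw.continuousOn.mono (hp _), ⟨wt, wl, wll, hwt.mono (hp _), hwl.mono (hp _),
    hwll.mono (hp _), fun t ht l hl => ?_, fun t ht => hneu t (hJ ht)⟩,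
    fun t ht => hw.dirichlet t (hJ ht)⟩
  obtain ⟨h1, h2⟩ := hder t (hJ ht) l hl
  exact ⟨h1.mono hJ, h2⟩

theorem IsHeatSolution.comp_add_const (hw : IsHeatSolution γ univ S u w) (a : ℝ) :
    IsHeatSolution γ univ S (fun t => u (t + a)) (fun t l => w (t + a) l) := by
  obtain ⟨wt, wl, wll, hwt, hwl, hwll, hder, hneu⟩ := hw.heat_neumann
  have hc : ∀ (A : Set ℝ) (g : ℝ → ℝ → ℝ),
      ContinuousOn (fun p : ℝ × ℝ => g p.1 p.2) (univ ×ˢ A) →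
      ContinuousOn (fun p : ℝ × ℝ => g (p.1 + a) p.2) (univ ×ˢ A) := fun A g hg =>
    hg.comp (f := fun p : ℝ × ℝ => (p.1 + a, p.2)) (by fun_prop) fun p hp => ⟨trivial, hp.2⟩
  refine ⟨hc _ _ hw.continuousOn, ⟨fun t => wt (t + a), fun t => wl (t + a), fun t => wll (t + a),
    hc _ _ hwt, hc _ _ hwl, hc _ _ hwll, fun t _ l hl => ?_, fun t _ => hneu _ trivial⟩,
    fun t _ => hw.dirichlet _ trivial⟩
  obtain ⟨h1, h2⟩ := hder (t + a) trivial l hl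
  refine ⟨?_, h2⟩
  rw [hasDerivWithinAt_univ] at h1 ⊢
  exact h1.comp_add_const t a

theorem IsHeatSolution.congr (hw : IsHeatSolution γ J S u w) (hS : S ⊆ Icc 0 1)
    (h : ∀ t ∈ J, ∀ l ∈ Icc (0 : ℝ) 1, w' t l = w t l) :
    IsHeatSolution γ J S u w' := by
  obtain ⟨wt, wl, wll, hwt, hwl, hwll, hder, hneu⟩ := hw.heat_neumann
  refine ⟨hw.continuousOn.congr fun p hp => h _ hp.1 _ hp.2, ⟨wt, wl, wll, hwt, hwl, hwll,
    fun t ht l hl => ?_, hneu⟩, fun t ht => ?_⟩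
  · obtain ⟨h1, h2, h3, h4⟩ := hder t ht l hl
    exact ⟨h1.congr (fun s hs => h s hs l (hS hl)) (h t ht l (hS hl)),
      h2.congr (fun r hr => h t ht r (hS hr)) (h t ht l (hS hl)), h3,
      by rw [h4, h t ht l (hS hl)]⟩
  · rw [h t ht 1 ⟨zero_le_one, le_rfl⟩, hw.dirichlet t ht]

end
-- Steady solutions, the flow, and their combination.
section
open MeasureTheory Filter Topology

variable {γ γ₀ : ℝ} {u : ℝ → ℝ} {w w' : ℝ → ℝ → ℝ}

theorem IsHeatSolution.intervalIntegrable_sq {S : Set ℝ}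
    (hw : IsHeatSolution γ (Iic 0) S u w) {t : ℝ} (ht : t ≤ 0) :
    IntervalIntegrable (fun l => w t l ^ 2) volume 0 1 := by
  refine ContinuousOn.intervalIntegrable ?_
  rw [uIcc_of_le zero_le_one]
  exact (hw.continuousOn.comp (f := fun s : ℝ => (t, s)) (by fun_prop)
    fun s hs => ⟨ht, hs⟩).pow 2

theorem IsSteadySolution.exists_integral_sq_le (hw : IsSteadySolution γ u w) :
    ∃ M : ℝ, ∀ t ≤ 0, Real.exp (γ * t) ^ 2 * ∫ l in (0 : ℝ)..1, w t l ^ 2 ≤ M := by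
  obtain ⟨C, hC, h⟩ := hw.growth
  refine ⟨C ^ 2, fun t ht => ?_⟩
  have h1 := ((Real.sqrt_lt' (by positivity)).1 (h t ht)).le
  calc _ ≤ Real.exp (γ * t) ^ 2 * (C * Real.exp (-γ * t)) ^ 2 := by gcongr
    _ = (C * (Real.exp (γ * t) * Real.exp (-γ * t))) ^ 2 := by ring
    _ = C ^ 2 := by rw [← Real.exp_add]; simp

/-- The growth rate `exp (-γ t)` is exactly what the factor `exp (γ t)` compensates, so the rescaled
difference is bounded in `L²`. -/
theorem IsSteadySolution.eq (hw : IsSteadySolution γ u w) (hw' : IsSteadySolution γ u w') :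
    ∀ t ≤ 0, ∀ l ∈ Icc (0 : ℝ) 1, w t l = w' t l := by
  have hd := (hw.isHeatSolution.sub hw'.isHeatSolution).exp_mul Ico_subset_Icc_self (-γ)
  simp only [sub_self, mul_zero, add_neg_cancel, neg_neg] at hd
  obtain ⟨M, hM⟩ := hw.exists_integral_sq_le
  obtain ⟨M', hM'⟩ := hw'.exists_integral_sq_le
  have h0 := eq_zero_of_isHeatSolution hd (M := 2 * M + 2 * M') fun t ht => by
    have hi := hw.isHeatSolution.intervalIntegrable_sq ht
    have hi' := hw'.isHeatSolution.intervalIntegrable_sq ht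
    calc ∫ l in (0 : ℝ)..1, (Real.exp (γ * t) * (w t l - w' t l)) ^ 2
        ≤ ∫ l in (0 : ℝ)..1, (2 * Real.exp (γ * t) ^ 2 * w t l ^ 2 +
            2 * Real.exp (γ * t) ^ 2 * w' t l ^ 2) := by
          refine intervalIntegral.integral_mono_on zero_le_one ?_
            ((hi.const_mul _).add (hi'.const_mul _)) fun l _ => ?_
          · refine ContinuousOn.intervalIntegrable ?_
            rw [uIcc_of_le zero_le_one]
            exact (hd.continuousOn.comp (f := fun s : ℝ => (t, s)) (by fun_prop)
              fun s hs => ⟨ht, hs⟩).pow 2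
          · nlinarith [sq_nonneg (Real.exp (γ * t) * (w t l + w' t l))]
      _ = 2 * (Real.exp (γ * t) ^ 2 * ∫ l in (0 : ℝ)..1, w t l ^ 2) +
            2 * (Real.exp (γ * t) ^ 2 * ∫ l in (0 : ℝ)..1, w' t l ^ 2) := by
          rw [intervalIntegral.integral_add (hi.const_mul _) (hi'.const_mul _),
            intervalIntegral.integral_const_mul, intervalIntegral.integral_const_mul]
          ring
      _ ≤ _ := by linarith [hM t ht, hM' t ht]
  intro t ht l hl
  have := (mul_eq_zero.1 (h0 t ht l hl)).resolve_left (Real.exp_pos _).ne'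
  linarith

theorem IsSteadySolution.steadySolution_eq (hw : IsSteadySolution γ u w) :
    ∀ t ≤ 0, ∀ l ∈ Icc (0 : ℝ) 1, steadySolution γ u t l = w t l := by
  have hex : ∃ w, IsSteadySolution γ u w := ⟨w, hw⟩
  rw [steadySolution, dif_pos hex]
  exact hex.choose_spec.eq hw

theorem hasExpDecay_exp_mul (hγ : γ₀ < γ) (hu : Continuous u)
    {C : ℝ} (hC : ∀ t ≤ 0, Real.exp (γ₀ * t) * |u t| ≤ C) :
    HasExpDecay (γ - γ₀) (fun t => Real.exp (γ * t) * u t) := by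
  have hc : Continuous (fun t => Real.exp (γ * t) * u t) := by fun_prop
  refine ⟨hc, fun T => ?_⟩
  obtain ⟨M, hM⟩ := isCompact_Icc.exists_bound_of_continuousOn (s := Icc 0 T) hc.continuousOn
  refine ⟨|C| + |M|, fun t ht => ?_⟩
  rcases le_total t 0 with h | h
  · calc |Real.exp (γ * t) * u t| =
          (Real.exp (γ₀ * t) * |u t|) * Real.exp ((γ - γ₀) * t) := by
          rw [abs_mul, abs_of_pos (Real.exp_pos _), mul_right_comm, ← Real.exp_add]
          ring_nf
      _ ≤ (|C| + |M|) * Real.exp ((γ - γ₀) * t) := by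
          gcongr
          exact (hC t h).trans ((le_abs_self C).trans (le_add_of_nonneg_right (abs_nonneg M)))
  · have h1 : 1 ≤ Real.exp ((γ - γ₀) * t) := Real.one_le_exp (by nlinarith)
    calc |Real.exp (γ * t) * u t| ≤ M := hM t ⟨h, ht⟩
      _ ≤ |C| + |M| := (le_abs_self M).trans (le_add_of_nonneg_left (abs_nonneg C))
      _ ≤ _ := le_mul_of_one_le_right (by positivity) h1

theorem exists_isHeatSolution_univ (hγ : γ₀ < γ) (hu : Continuous u)
    {C : ℝ} (hC : ∀ t ≤ 0, Real.exp (γ₀ * t) * |u t| ≤ C) :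
    ∃ w : ℝ → ℝ → ℝ, IsHeatSolution γ univ (Ico 0 1) u w ∧
      (ContDiff ℝ 1 u → IsHeatSolution γ univ (Icc 0 1) u w) ∧
      ∀ T : ℝ, ∃ K : ℝ, ∀ t ≤ T, ∀ l ∈ Icc (0 : ℝ) 1, |w t l| ≤ K * Real.exp (-γ * t) := by
  obtain ⟨v, hv, hv1, hvb⟩ := exists_heatSolution (sub_pos.2 hγ) (hasExpDecay_exp_mul hγ hu hC)
  have he : (fun t => Real.exp (-γ * t) * (Real.exp (γ * t) * u t)) = u := by
    ext t
    rw [← mul_assoc, ← Real.exp_add]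
    simp
  refine ⟨fun t l => Real.exp (-γ * t) * v t l, ?_, fun hu1 => ?_, fun T => ?_⟩
  · have := hv.exp_mul Ico_subset_Icc_self γ
    rwa [zero_add, he] at this
  · have := (hv1 (by fun_prop)).exp_mul Subset.rfl γ
    rwa [zero_add, he] at this
  · obtain ⟨K, hK⟩ := hvb T
    refine ⟨K, fun t ht l hl => ?_⟩
    rw [abs_mul, abs_of_pos (Real.exp_pos _), mul_comm]
    gcongr
    exact hK t ht l hl

theorem IsHeatSolution.isSteadySolution_comp_add (hw : IsHeatSolution γ univ (Ico 0 1) u w)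
    {a K : ℝ} (hK : ∀ t ≤ a, ∀ l ∈ Icc (0 : ℝ) 1, |w t l| ≤ K * Real.exp (-γ * t)) :
    IsSteadySolution γ (fun t => u (t + a)) (fun t l => w (t + a) l) := by
  have hK0 : 0 ≤ K := nonneg_of_mul_nonneg_left
    ((abs_nonneg _).trans (hK a le_rfl 0 ⟨le_rfl, zero_le_one⟩)) (Real.exp_pos _)
  -- The summand `1` makes the growth inequality strict.
  refine ⟨(hw.comp_add_const a).mono (subset_univ _), K * Real.exp (-γ * a) + 1, by positivity,
    fun t ht => ?_⟩
  have h1 : ∀ l ∈ uIoc (0 : ℝ) 1,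
      ‖w (t + a) l ^ 2‖ ≤ (K * Real.exp (-γ * a) * Real.exp (-γ * t)) ^ 2 := fun l hl => by
    rw [uIoc_of_le zero_le_one] at hl
    have := hK (t + a) (by linarith) l ⟨hl.1.le, hl.2⟩
    rw [norm_pow]
    refine pow_le_pow_left₀ (norm_nonneg _) (this.trans_eq ?_) 2
    rw [mul_assoc, ← Real.exp_add]
    ring_nf
  have h2 := intervalIntegral.norm_integral_le_of_norm_le_const h1
  rw [sub_zero, abs_one, mul_one] at h2
  calc _ ≤ Real.sqrt ((K * Real.exp (-γ * a) * Real.exp (-γ * t)) ^ 2) :=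
        Real.sqrt_le_sqrt ((le_abs_self _).trans h2)
    _ = K * Real.exp (-γ * a) * Real.exp (-γ * t) := Real.sqrt_sq (by positivity)
    _ < (K * Real.exp (-γ * a) + 1) * Real.exp (-γ * t) := by
        gcongr
        linarith

variable {n : ℕ} {f : EuclideanSpace ℝ (Fin n) → EuclideanSpace ℝ (Fin n)}
  {x : EuclideanSpace ℝ (Fin n)} {c c' : ℝ → EuclideanSpace ℝ (Fin n)}

theorem IsTrajectory.continuous (hc : IsTrajectory f x c) : Continuous c :=
  continuous_iff_continuousAt.2 fun t => (hc.2 t).continuousAt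

/-- On a bounded time interval both curves stay in one compact set, where a locally Lipschitz field
is Lipschitz. -/
theorem IsTrajectory.eq (hf : LocallyLipschitz f) (hc : IsTrajectory f x c)
    (hc' : IsTrajectory f x c') : c = c' := by
  ext1 t
  set R := |t| + 1
  set A := c '' Icc (-R) R ∪ c' '' Icc (-R) R
  have hA : IsCompact A :=
    (isCompact_Icc.image hc.continuous).union (isCompact_Icc.image hc'.continuous)
  obtain ⟨K, hK⟩ := (hf.locallyLipschitzOn (s := A)).exists_lipschitzOnWith_of_compact hA
  refine ODE_solution_unique_of_mem_Ioo (v := fun _ => f) (s := fun _ => A) (K := K) (t₀ := 0)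
    (a := -R) (b := R) (fun _ _ => hK) ?_
    (fun s hs => ⟨hc.2 s, Or.inl ⟨s, Ioo_subset_Icc_self hs, rfl⟩⟩)
    (fun s hs => ⟨hc'.2 s, Or.inr ⟨s, Ioo_subset_Icc_self hs, rfl⟩⟩) (hc.1.trans hc'.1.symm) ?_
  · constructor <;> linarith [abs_nonneg t, (rfl : R = |t| + 1)]
  · constructor <;> linarith [neg_abs_le t, le_abs_self t, (rfl : R = |t| + 1)]

theorem IsTrajectory.flow_eq (hf : LocallyLipschitz f) (hc : IsTrajectory f x c) (t : ℝ) :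
    flow f t x = c t := by
  have hex : ∃ c, IsTrajectory f x c := ⟨c, hc⟩
  rw [flow, dif_pos hex, hex.choose_spec.eq hf hc]

theorem IsTrajectory.flow_flow (hf : LocallyLipschitz f) (hc : IsTrajectory f x c) (t a : ℝ) :
    flow f t (flow f a x) = flow f (t + a) x := by
  have hs : IsTrajectory f (c a) (fun s => c (s + a)) :=
    ⟨by simp, fun s => (hc.2 (s + a)).comp_add_const s a⟩
  rw [hc.flow_eq hf, hc.flow_eq hf, hs.flow_eq hf]

theorem exists_heatSolution_along_flow (hf : LocallyLipschitz f)
    {h : EuclideanSpace ℝ (Fin n) → ℝ} (hh : Continuous h) (hc : IsTrajectory f x c)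
    {C : ℝ} (hC : ∀ t : ℝ, t ≤ 0 → Real.exp (γ₀ * t) * |h (flow f t x)| ≤ C) (hγ : γ₀ < γ) :
    ∃ w : ℝ → ℝ → ℝ,
      IsHeatSolution γ univ (Ico 0 1) (fun t => -h (flow f t x)) w ∧
      (ContDiff ℝ 1 (fun t => h (flow f t x)) →
        IsHeatSolution γ univ (Icc 0 1) (fun t => -h (flow f t x)) w) ∧
      ∀ a, IsSteadySolution γ (boundaryInput f h (flow f a x)) (fun t l => w (t + a) l) := by
  have hu : Continuous (fun t => -h (flow f t x)) := by
    simp_rw [hc.flow_eq hf]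
    exact (hh.comp hc.continuous).neg
  obtain ⟨w, hw, hw1, hwb⟩ := exists_isHeatSolution_univ hγ hu (C := C) (by simpa using hC)
  refine ⟨w, hw, fun h1 => hw1 h1.neg, fun a => ?_⟩
  obtain ⟨K, hK⟩ := hwb a
  have := hw.isSteadySolution_comp_add hK
  have he : boundaryInput f h (flow f a x) = fun t => -h (flow f (t + a) x) :=
    funext fun t => by rw [boundaryInput, hc.flow_flow hf]
  rwa [he]

end

/-! ### The main theorem. -/

theorem mainTheorem5 (n : ℕ)
    (f : EuclideanSpace ℝ (Fin n) → EuclideanSpace ℝ (Fin n)) (hf : LocallyLipschitz f)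
    (h : EuclideanSpace ℝ (Fin n) → ℝ) (hh : Continuous h)
    (X₀ : Set (EuclideanSpace ℝ (Fin n))) (hX₀ : IsOpen X₀)
    (hglobal : ∀ x ∈ X₀, ∃ c : ℝ → EuclideanSpace ℝ (Fin n), IsTrajectory f x c)
    (γ₀ : ℝ) (hγ₀ : 0 < γ₀)
    (hbound : ∀ x ∈ X₀, ∃ C : ℝ, 0 < C ∧
      ∀ t : ℝ, t ≤ 0 → Real.exp (γ₀ * t) * |h (flow f t x)| ≤ C)
    (γ : ℝ) (hγ : γ₀ < γ) :
    -- `T₀` is well defined on `𝒳`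
    (∀ x ∈ trajectorySet f X₀, ∃ w : ℝ → ℝ → ℝ,
      IsSteadySolution γ (boundaryInput f h x) w ∧
      (∀ w' : ℝ → ℝ → ℝ, IsSteadySolution γ (boundaryInput f h x) w' →
        ∀ t ∈ Set.Iic (0 : ℝ), ∀ l ∈ Set.Icc (0 : ℝ) 1, w' t l = w t l) ∧
      ∀ l ∈ Set.Icc (0 : ℝ) 1, kklMap γ f h x l = w 0 l) ∧
    -- `T₀` solves the heat equation along the flow
    (∀ x ∈ X₀,
      IsHeatSolution γ (Set.Ici 0) (Set.Ico 0 1) (fun t => -h (flow f t x))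
        (fun t l => kklMap γ f h (flow f t x) l)) ∧
    -- up to the boundary point `1` when the boundary datum is continuously differentiable
    (∀ x ∈ X₀, ContDiff ℝ 1 (fun t : ℝ => h (flow f t x)) →
      IsHeatSolution γ (Set.Ici 0) (Set.Icc 0 1) (fun t => -h (flow f t x))
        (fun t l => kklMap γ f h (flow f t x) l)) := by
  have key : ∀ x ∈ X₀, ∃ w : ℝ → ℝ → ℝ,
      IsHeatSolution γ univ (Ico 0 1) (fun t => -h (flow f t x)) w ∧
      (ContDiff ℝ 1 (fun t => h (flow f t x)) →
        IsHeatSolution γ univ (Icc 0 1) (fun t => -h (flow f t x)) w) ∧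
      (∀ a, IsSteadySolution γ (boundaryInput f h (flow f a x)) (fun t l => w (t + a) l)) ∧
      ∀ a, ∀ l ∈ Icc (0 : ℝ) 1, kklMap γ f h (flow f a x) l = w a l := by
    intro x hx
    obtain ⟨c, hc⟩ := hglobal x hx
    obtain ⟨C, -, hC⟩ := hbound x hx
    obtain ⟨w, hw, hw1, hws⟩ := exists_heatSolution_along_flow hf hh hc hC hγ
    refine ⟨w, hw, hw1, hws, fun a l hl => ?_⟩
    -- `T₀` reads the steady solution at time `0`, which is time `a` for the untranslated `w`.
    have := (hws a).steadySolution_eq 0 le_rfl l hl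
    rwa [zero_add] at this
  refine ⟨?_, fun x hx => ?_, fun x hx h1 => ?_⟩
  · rintro _ ⟨x, hx, a, -, rfl⟩
    obtain ⟨w, -, -, hws, hk⟩ := key x hx
    refine ⟨fun t l => w (t + a) l, hws a, fun w' hw' => hw'.eq (hws a), fun l hl => ?_⟩
    simp only [hk a l hl, zero_add]
  · obtain ⟨w, hw, -, -, hk⟩ := key x hx
    exact (hw.mono (subset_univ _)).congr Ico_subset_Icc_self fun t _ l hl => hk t l hl
  · obtain ⟨w, -, hw, -, hk⟩ := key x hx
    exact ((hw h1).mono (subset_univ _)).congr Subset.rfl fun t _ l hl => hk t l hl
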